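/- **Theorem 4.5.** Let $m\ge 1$ and let $M\subset\mathbb R^n$ be a simply connected finite-cell PL $m$-manifold, with or without boundary: $M$ is a finite union of convex polytopes (cells), and every point of $M$ has a neighbourhood in $M$ that is piecewise linearly homeomorphic to the closed cube $[0,1]^m$. (In particular $M$ may be closed, i.e. have empty boundary.) Let $B$ be a closed (compact, without boundary) connected PL $(m-1)$-manifold contained in the interior $M\setminus\partial M$; in particular, $B$ may be any closed simply connected PL $(m-1)$-manifold there. Then $B$ separates $M$ into two components: $M\setminus B$ has exactly two connected components. -/

import Mathlib

open Set Topology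

/-- A convex cell (compact convex polytope): the convex hull of a finite set of points. -/
def IsConvexCell {E : Type*} [AddCommGroup E] [Module ℝ E] (C : Set E) : Prop :=
  ∃ s : Set E, s.Finite ∧ C = convexHull ℝ s

/-- `𝒞` is a decomposition of `P` into finitely many convex cells. The cells may overlap in an
arbitrary way, so every finite simplicial, cubical or polytopal complex with underlying set `P`
is an instance. -/
def IsFiniteCellCover {E : Type*} [AddCommGroup E] [Module ℝ E]
    (𝒞 : Set (Set E)) (P : Set E) : Prop :=
  𝒞.Finite ∧ (∀ C ∈ 𝒞, IsConvexCell C) ∧ ⋃₀ 𝒞 = P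

/-- A compact polyhedron: a union of finitely many convex cells. -/
def IsCompactPolyhedron {E : Type*} [AddCommGroup E] [Module ℝ E] (P : Set E) : Prop :=
  ∃ 𝒞 : Set (Set E), IsFiniteCellCover 𝒞 P

/-- `f` is piecewise linear on the compact polyhedron `P`: there are finitely many convex cells
with union `P` such that `f` agrees with an affine map on each of them. (Such an `f` is
continuous on `P`, because the cells are closed.) -/
def IsPLOn {E F : Type*} [AddCommGroup E] [Module ℝ E] [AddCommGroup F] [Module ℝ F]
    (f : E → F) (P : Set E) : Prop :=
  ∃ 𝒞 : Set (Set E), IsFiniteCellCover 𝒞 P ∧ ∀ C ∈ 𝒞, ∃ a : E →ᵃ[ℝ] F, EqOn f a C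

/-- `f` restricts to a piecewise linear homeomorphism from `P` onto `Q`, with inverse `g`. -/
def IsPLHomeo {E F : Type*} [AddCommGroup E] [Module ℝ E] [AddCommGroup F] [Module ℝ F]
    (f : E → F) (g : F → E) (P : Set E) (Q : Set F) : Prop :=
  IsPLOn f P ∧ IsPLOn g Q ∧ MapsTo f P Q ∧ MapsTo g Q P ∧ InvOn g f P Q

/-- The standard `m`-dimensional cube `[0, 1] ^ m`. -/
def stdCube (m : ℕ) : Set (Fin m → ℝ) := Icc 0 1

/-- `f`, with inverse `g`, is a piecewise linear chart of `P` around `x`: it is defined on a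
neighbourhood `N` of `x` in `P` and maps `N` onto the closed `m`-cube. -/
def IsPLChartAt {E : Type*} [AddCommGroup E] [Module ℝ E] [TopologicalSpace E] (m : ℕ)
    (P : Set E) (x : E) (N : Set E) (f : E → Fin m → ℝ) (g : (Fin m → ℝ) → E) : Prop :=
  N ⊆ P ∧ N ∈ 𝓝[P] x ∧ IsPLHomeo f g N (stdCube m)

/-- A finite-cell PL `m`-manifold, with or without boundary: a compact polyhedron in which every
point has a neighbourhood that is PL homeomorphic to the closed `m`-cube. -/
def IsPLManifold {E : Type*} [AddCommGroup E] [Module ℝ E] [TopologicalSpace E] (m : ℕ)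
    (P : Set E) : Prop :=
  IsCompactPolyhedron P ∧ ∀ x ∈ P, ∃ N f g, IsPLChartAt m P x N f g

/-- The manifold interior of `P` in dimension `m`: the points that some chart sends to an interior
point of the cube. -/
def plInterior {E : Type*} [AddCommGroup E] [Module ℝ E] [TopologicalSpace E] (m : ℕ)
    (P : Set E) : Set E :=
  {x | x ∈ P ∧ ∃ N f g, IsPLChartAt m P x N f g ∧ f x ∈ interior (stdCube m)}

/-- A closed PL `m`-manifold: compact and without boundary. -/
def IsClosedPLManifold {E : Type*} [AddCommGroup E] [Module ℝ E] [TopologicalSpace E] (m : ℕ)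
    (P : Set E) : Prop :=
  IsPLManifold m P ∧ P ⊆ plInterior m P

/-!
A chart of `M` around a point of `B`, read in a chart of `B`, is an injective piecewise affine map
`ℝᵐ⁻¹ → ℝᵐ`. Off a set of codimension 2 it is affine or bent along a single hyperplane, so near such
points `B` has exactly two sides. The remaining bad points have codimension 2 in `B` and 3 in `M`.

Two functions `M ∖ B → ZMod 2` that locally tell apart the sides of `B` differ by a locally
constant function. Hence the local choices form a Čech cocycle, and they glue because `M` is simply
connected. Near a bad point, the same argument is applied to a star-shaped open set that avoids the
bad set and has a complement of codimension 2, across which locally constant functions extend.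

Each fibre of the glued function is open in `M` minus the bad set, and its frontier there is `B`
minus the bad set. Both of these are connected, and `B` meets each fibre locally in one side, so the
fibres are connected: they are the two components of `M ∖ B`.
-/

open Filter

section Germs

variable {X A : Type*} [TopologicalSpace X] {s K V : Set X} {x : X}

/-- `K` does not locally separate the space at `x`: arbitrarily small neighbourhoods of `x` stay
connected when `K` is removed. -/
def LocallyNonseparatingAt (K : Set X) (x : X) : Prop :=
  ∀ W ∈ 𝓝 x, ∃ V ∈ 𝓝 x, V ⊆ W ∧ IsPreconnected (V \ K)

theorem locallyNonseparatingAt_of_notMem_closure [LocallyConnectedSpace X] (hx : x ∉ closure K) :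
    LocallyNonseparatingAt K x := by
  intro W hW
  obtain ⟨V, hVW, hV, hxV, hVc⟩ := locallyConnectedSpace_iff_subsets_isOpen_isConnected.1 ‹_› x
    (W \ closure K) (Filter.sdiff_mem hW (isClosed_closure.isOpen_compl.mem_nhds hx))
  refine ⟨V, hV.mem_nhds hxV, hVW.trans sdiff_subset, ?_⟩
  rw [sdiff_eq_left.2 (disjoint_left.2 fun y hy hyK => (hVW hy).2 (subset_closure hyK))]
  exact hVc.isPreconnected

section EventuallyConst

variable [TopologicalSpace A] [DiscreteTopology A] {g : X → A}

theorem eventuallyConst_of_continuousWithinAt (h : ContinuousWithinAt g s x) :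
    EventuallyConst g (𝓝[s] x) :=
  .of_tendsto <| by simpa only [ContinuousWithinAt, nhds_discrete] using h

variable [Nonempty A]

theorem eventuallyConst_iff_exists_tendsto {α : Type*} {l : Filter α} {g : α → A} :
    EventuallyConst g l ↔ ∃ a, Tendsto g l (𝓝 a) := by
  simp only [eventuallyConst_iff_tendsto, nhds_discrete]

theorem eventually_eq_extendFrom (h : EventuallyConst g (𝓝[s] x)) :
    ∀ᶠ y in 𝓝[s] x, g y = extendFrom s g x := by
  simpa only [nhds_discrete, tendsto_pure] using
    tendsto_extendFrom (eventuallyConst_iff_exists_tendsto.1 h)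

theorem continuousWithinAt_of_eventuallyConst (hx : x ∈ s) (h : EventuallyConst g (𝓝[s] x)) :
    ContinuousWithinAt g s x := by
  have hgx := (eventually_eq_extendFrom h).self_of_nhdsWithin hx
  rw [ContinuousWithinAt, hgx]
  exact tendsto_extendFrom (eventuallyConst_iff_exists_tendsto.1 h)

theorem eventually_eventuallyConst_nhdsWithin (h : EventuallyConst g (𝓝[s] x)) :
    ∀ᶠ y in 𝓝 x, EventuallyConst g (𝓝[s] y) :=
  (eventually_nhds_nhdsWithin.2 (eventually_eq_extendFrom h)).mono fun _ hy =>
    eventuallyConst_iff_exists_eventuallyEq.2 ⟨_, hy⟩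

theorem continuousAt_extendFrom (hs : ∀ᶠ y in 𝓝 x, y ∈ closure s)
    (h : EventuallyConst g (𝓝[s] x)) : ContinuousAt (extendFrom s g) x := by
  refine continuousAt_const.congr (f := fun _ => extendFrom s g x) ?_
  filter_upwards [hs, eventually_nhds_nhdsWithin.2 (eventually_eq_extendFrom h)] with y hys hy
  exact (extendFrom_eq hys (tendsto_const_nhds.congr' (hy.mono fun _ => Eq.symm))).symm

theorem exists_forall_eventually_eq_of_isPreconnected (hV : IsPreconnected V)
    (hVs : V ⊆ closure s) (h : ∀ x ∈ V, EventuallyConst g (𝓝[s] x)) :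
    ∃ a, ∀ x ∈ V, ∀ᶠ y in 𝓝[s] x, g y = a := by
  obtain rfl | ⟨x₀, hx₀⟩ := V.eq_empty_or_nonempty
  · exact ⟨Classical.arbitrary A, by simp⟩
  refine ⟨extendFrom s g x₀, fun x hx => ?_⟩
  have hcont : ContinuousOn (extendFrom s g) V :=
    continuousOn_extendFrom hVs fun x hx => eventuallyConst_iff_exists_tendsto.1 (h x hx)
  rw [hV.constant hcont hx₀ hx]
  exact eventually_eq_extendFrom (h x hx)

theorem LocallyNonseparatingAt.eventuallyConst (hK : LocallyNonseparatingAt K x)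
    (hs : ∀ᶠ y in 𝓝 x, y ∈ closure s) (hsK : Disjoint s K)
    (h : ∀ᶠ y in 𝓝 x, y ∉ K → EventuallyConst g (𝓝[s] y)) : EventuallyConst g (𝓝[s] x) := by
  obtain ⟨V, hV, hVW, hVc⟩ := hK _ (hs.and h)
  obtain ⟨a, ha⟩ := exists_forall_eventually_eq_of_isPreconnected hVc (fun y hy => (hVW hy.1).1)
    fun y hy => (hVW hy.1).2 hy.2
  refine eventuallyConst_iff_exists_eventuallyEq.2 ⟨a, ?_⟩
  filter_upwards [mem_nhdsWithin_of_mem_nhds hV, self_mem_nhdsWithin] with y hyV hys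
  exact (ha y ⟨hyV, disjoint_left.1 hsK hys⟩).self_of_nhdsWithin hys

end EventuallyConst

theorem isPreconnected_compl_of_locallyNonseparatingAt [PreconnectedSpace X] (hK : Dense Kᶜ)
    (h : ∀ x, LocallyNonseparatingAt K x) : IsPreconnected Kᶜ := by
  refine isPreconnected_of_forall_constant fun f hf x hx y hy => ?_
  have hconst : ∀ z, EventuallyConst f (𝓝[Kᶜ] z) := fun z =>
    (h z).eventuallyConst (.of_forall hK) disjoint_compl_left <|
      .of_forall fun y hy => eventuallyConst_of_continuousWithinAt (hf y hy)
  obtain ⟨a, ha⟩ := exists_forall_eventually_eq_of_isPreconnected isPreconnected_univ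
    (fun z _ => hK z) fun z _ => hconst z
  rw [(ha x trivial).self_of_nhdsWithin hx, (ha y trivial).self_of_nhdsWithin hy]

end Germs

section Gluing

variable {X A : Type*} [TopologicalSpace X]

/-- The first Čech cohomology of a simply connected space with discrete coefficients vanishes: the
cocycle `c` defines a covering space, and `σ` is read off from a global section. -/
theorem exists_continuousOn_eq_add_of_cocycle [SimplyConnectedSpace X]
    [LocallyPathConnectedSpace X] [AddGroup A] [TopologicalSpace A] [DiscreteTopology A]
    {ι : Type*} {D : ι → Set X} {c : ι → ι → X → A} (hD : ∀ i, IsOpen (D i))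
    (hcover : ∀ x, ∃ i, x ∈ D i) (hc : ∀ i j, ContinuousOn (c i j) (D i ∩ D j))
    (hcocycle : ∀ i j k, ∀ x ∈ D i ∩ D j ∩ D k, c i j x + c j k x = c i k x) :
    ∃ σ : ι → X → A, (∀ i, ContinuousOn (σ i) (D i)) ∧
      ∀ i j, ∀ x ∈ D i ∩ D j, σ i x = c i j x + σ j x := by
  choose idx hidx using hcover
  let Z : FiberBundleCore ι X A :=
    { baseSet := D
      isOpen_baseSet := hD
      indexAt := idx
      mem_baseSet_at := hidx
      coordChange := fun i j x v => c j i x + v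
      coordChange_self := fun i x hx v => by
        have : c i i x + c i i x = c i i x := hcocycle i i i x ⟨⟨hx, hx⟩, hx⟩
        rw [add_eq_left.1 this, zero_add]
      continuousOn_coordChange := fun i j =>
        (((hc j i).mono fun x hx => hx.symm).comp continuousOn_fst fun p hp => hp.1).add
          continuousOn_snd
      coordChange_comp := fun i j k x hx v => by
        rw [← add_assoc, hcocycle k j i x ⟨⟨hx.2, hx.1.2⟩, hx.1.1⟩] }
  have hcov : IsCoveringMap (Bundle.TotalSpace.proj : Bundle.TotalSpace A Z.Fiber → X) :=
    FiberBundle.isCoveringMap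
  obtain ⟨x₀⟩ : Nonempty X := inferInstance
  obtain ⟨s, ⟨-, hs⟩, -⟩ := hcov.existsUnique_continuousMap_lifts (ContinuousMap.id X) x₀
    (⟨x₀, (0 : A)⟩ : Bundle.TotalSpace A Z.Fiber) rfl
  have hproj : ∀ x, (s x).proj = x := congrFun hs
  let v : X → A := fun x => (s x).2
  have hσ : ∀ i x, (Z.localTriv i (s x)).2 = c i (idx x) x + v x := fun i x => by
    change c i (idx (s x).proj) (s x).proj + v x = _
    rw [hproj]
  refine ⟨fun i x => (Z.localTriv i (s x)).2, fun i => ?_, fun i j x hx => ?_⟩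
  · refine continuous_snd.comp_continuousOn
      ((Z.localTriv i).continuousOn.comp s.continuous.continuousOn fun x hx => ?_)
    rw [Bundle.Trivialization.mem_source]
    simpa only [hproj] using! hx
  · simp only [hσ]
    rw [← add_assoc, hcocycle i j _ x ⟨hx, hidx x⟩]

variable [AddCommGroup A] {s K : Set X} {f g h : X → A} {x : X}

/-- Near `x` and on `s`, the functions `f` and `g` differ by a constant. -/
def EqModConstAt (s : Set X) (f g : X → A) (x : X) : Prop :=
  EventuallyConst (f - g) (𝓝[s] x)

theorem EqModConstAt.symm (hfg : EqModConstAt s f g x) : EqModConstAt s g f x := by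
  simpa only [EqModConstAt, neg_sub] using! hfg.neg

theorem EqModConstAt.trans (hfg : EqModConstAt s f g x) (hgh : EqModConstAt s g h x) :
    EqModConstAt s f h x := by
  simpa only [EqModConstAt, sub_add_sub_cancel] using! hfg.add hgh

theorem exists_eqModConstAt [SimplyConnectedSpace X] [LocallyPathConnectedSpace X]
    (hs : Dense s) {p : X → X → A} (hp : ∀ x, ∀ᶠ y in 𝓝 x, EqModConstAt s (p x) (p y) y) :
    ∃ F : X → A, ∀ x, EqModConstAt s F (p x) x := by
  let _ : TopologicalSpace A := ⊥
  have : DiscreteTopology A := ⟨rfl⟩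
  let D : X → Set X := fun x => interior {y | EqModConstAt s (p x) (p y) y}
  have hxD : ∀ x, D x ∈ 𝓝 x := fun x => interior_mem_nhds.2 (hp x)
  have hD : ∀ {i j x}, x ∈ D i ∩ D j → EventuallyConst (p j - p i) (𝓝[s] x) := fun hx =>
    (interior_subset hx.2).trans (interior_subset hx.1).symm
  let c : X → X → X → A := fun i j => extendFrom s (p j - p i)
  have hc : ∀ {i j x}, x ∈ D i ∩ D j → Tendsto (p j - p i) (𝓝[s] x) (𝓝 (c i j x)) := fun hx =>
    tendsto_extendFrom (eventuallyConst_iff_exists_tendsto.1 (hD hx))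
  obtain ⟨σ, hσ, hσc⟩ := exists_continuousOn_eq_add_of_cocycle (c := c) (D := D)
    (fun _ => isOpen_interior) (fun x => ⟨x, mem_of_mem_nhds (hxD x)⟩)
    (fun i j x hx => (continuousAt_extendFrom (.of_forall hs) (hD hx)).continuousWithinAt)
    (fun i j k x hx => by
      refine (extendFrom_eq (hs x) ?_).symm
      exact ((hc hx.1).add (hc ⟨hx.1.2, hx.2⟩)).congr fun _ => sub_add_sub_cancel' ..)
  refine ⟨fun y => p y y + σ y y, fun x => ?_⟩
  have hσx : EventuallyConst (σ x) (𝓝[s] x) :=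
    eventuallyConst_of_continuousWithinAt ((hσ x).continuousAt (hxD x)).continuousWithinAt
  refine hσx.congr ?_
  filter_upwards [mem_nhdsWithin_of_mem_nhds (hxD x), self_mem_nhdsWithin] with y hy hys
  have hyD : y ∈ D y ∩ D x := ⟨mem_of_mem_nhds (hxD y), hy⟩
  have hcy : p x y - p y y = c y x y := (eventually_eq_extendFrom (hD hyD)).self_of_nhdsWithin hys
  simp only [Pi.sub_apply, hσc y x y hyD, ← hcy]
  abel

theorem exists_eqModConstAt_of_isOpen [LocallyPathConnectedSpace X] {T : Set X} (hT : IsOpen T)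
    [SimplyConnectedSpace T] (hs : Dense s) {p : X → X → A}
    (hp : ∀ x ∈ T, ∀ᶠ y in 𝓝 x, EqModConstAt s (p x) (p y) y) :
    ∃ F : X → A, ∀ x ∈ T, EqModConstAt s F (p x) x := by
  have hemb : IsOpenEmbedding (Subtype.val : T → X) := hT.isOpenEmbedding_subtypeVal
  have hiff : ∀ (f g : X → A) (y : T), EqModConstAt (Subtype.val ⁻¹' s) (f ∘ Subtype.val)
      (g ∘ Subtype.val) y ↔ EqModConstAt s f g y := fun f g y => by
    rw [EqModConstAt, EqModConstAt, ← hemb.map_nhdsWithin_preimage_eq]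
    rfl
  have : LocallyPathConnectedSpace T := hT.locallyPathConnectedSpace
  obtain ⟨F, hF⟩ := exists_eqModConstAt (s := (Subtype.val ⁻¹' s : Set T))
    (hs.preimage hemb.isOpenMap) (p := fun x y => p x y) fun x => by
      filter_upwards [continuous_subtype_val.continuousAt.eventually (hp x x.2)] with y hy
      exact (hiff _ _ _).2 hy
  refine ⟨Function.extend Subtype.val F 0, fun x hx => (hiff _ _ ⟨x, hx⟩).1 ?_⟩
  rw [Function.extend_comp Subtype.val_injective]
  exact hF ⟨x, hx⟩

/-- `f` is obtained by comparing a function glued on `T` with the local data `p`, and extending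
the difference, which is locally constant on `T`, across the complement of `T`. -/
theorem exists_eventually_eqModConstAt [LocallyPathConnectedSpace X] {T : Set X} (hT : IsOpen T)
    [SimplyConnectedSpace T] (hTK : Disjoint T K) (hs : Dense s) (hsK : Disjoint s K)
    {p : X → X → A} (hp : ∀ x ∉ K, ∀ᶠ y in 𝓝 x, y ∉ K → EqModConstAt s (p x) (p y) y)
    (hx : ∀ᶠ y in 𝓝 x, y ∈ closure T ∧ LocallyNonseparatingAt Tᶜ y) :
    ∃ f : X → A, ∀ᶠ y in 𝓝 x, y ∉ K → EqModConstAt s f (p y) y := by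
  let _ : TopologicalSpace A := ⊥
  have : DiscreteTopology A := ⟨rfl⟩
  have hTK' : ∀ y ∈ T, y ∉ K := fun _ hy => disjoint_left.1 hTK hy
  obtain ⟨χ, hχ⟩ := exists_eqModConstAt_of_isOpen hT hs fun y hy =>
    ((hp y (hTK' y hy)).and (hT.mem_nhds hy)).mono fun z hz => hz.1 (hTK' z hz.2)
  have hclosure : closure T ⊆ closure (s ∩ T) :=
    closure_minimal (inter_comm T s ▸ hs.open_subset_closure_inter hT) isClosed_closure
  refine ⟨fun z => p z z + extendFrom (s ∩ T) (χ - p z) z, ?_⟩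
  filter_upwards [eventually_eventually_nhds.2 hx] with y hy hyK
  have hcl : ∀ᶠ z in 𝓝 y, z ∈ closure (s ∩ T) := hy.mono fun z hz => hclosure hz.1
  have hconst : EventuallyConst (χ - p y) (𝓝[s ∩ T] y) := by
    refine hy.self_of_nhds.2.eventuallyConst hcl (disjoint_compl_right.mono_left inter_subset_right)
      ((hp y hyK).mono fun z hz hzT => ?_)
    have hzT' : z ∈ T := of_not_not hzT
    exact EventuallyConst.anti ((hχ z hzT').trans (hz (hTK' z hzT')).symm)
      (nhdsWithin_mono _ inter_subset_left)
  refine EventuallyConst.congr (eventuallyConst_of_continuousWithinAt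
    (continuousAt_extendFrom hcl hconst).continuousWithinAt) ?_
  filter_upwards [mem_nhdsWithin_of_mem_nhds hcl, mem_nhdsWithin_of_mem_nhds (hp y hyK),
    mem_nhdsWithin_of_mem_nhds (eventually_eventuallyConst_nhdsWithin hconst),
    self_mem_nhdsWithin] with z hzcl hzp hzconst hzs
  have hpz : Tendsto (p y - p z) (𝓝[s ∩ T] z) (𝓝 (p y z - p z z)) :=
    (continuousWithinAt_of_eventuallyConst hzs (hzp (disjoint_left.1 hsK hzs))).mono_left
      (nhdsWithin_mono _ inter_subset_left)
  have hχz := tendsto_extendFrom (eventuallyConst_iff_exists_tendsto.1 hzconst)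
  have hext := extendFrom_eq hzcl ((hχz.add hpz).congr fun w => sub_add_sub_cancel ..)
  change _ = p z z + extendFrom (s ∩ T) (fun w => χ w - p z w) z - p y z
  rw [hext]
  abel

theorem exists_eqModConstAt_of_locallyNonseparatingAt [SimplyConnectedSpace X]
    [LocallyPathConnectedSpace X] (hs : Dense s) (hsK : Disjoint s K) {p : X → X → A}
    (hp : ∀ x ∉ K, ∀ᶠ y in 𝓝 x, y ∉ K → EqModConstAt s (p x) (p y) y)
    (hK : ∀ x, LocallyNonseparatingAt K x)
    (hT : ∀ x ∈ K, ∃ T : Set X, IsOpen T ∧ Disjoint T K ∧ SimplyConnectedSpace T ∧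
      ∀ᶠ y in 𝓝 x, y ∈ closure T ∧ LocallyNonseparatingAt Tᶜ y) :
    ∃ F : X → A, ∀ x ∉ K, EqModConstAt s F (p x) x := by
  let _ : TopologicalSpace A := ⊥
  have : DiscreteTopology A := ⟨rfl⟩
  have hlocal : ∀ x, ∃ q : X → A, ∀ᶠ y in 𝓝 x, y ∉ K → EqModConstAt s q (p y) y := fun x => by
    by_cases hx : x ∈ K
    · obtain ⟨T, hTo, hTK, _, hxT⟩ := hT x hx
      exact exists_eventually_eqModConstAt hTo hTK hs hsK hp hxT
    · exact ⟨p x, hp x hx⟩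
  choose q hq using hlocal
  obtain ⟨F, hF⟩ := exists_eqModConstAt hs (p := q) fun x => by
    filter_upwards [eventually_eventually_nhds.2 (hq x)] with y hy
    exact (hK y).eventuallyConst (.of_forall hs) hsK <|
      (hy.and (hq y)).mono fun z hz hzK => (hz.1 hzK).trans (hz.2 hzK).symm
  exact ⟨F, fun x hx => (hF x).trans ((hq x).self_of_nhds hx)⟩

end Gluing

section TwoSided

variable {X : Type*} [TopologicalSpace X] {B U U₁ U₂ : Set X} {f g : X → ZMod 2} {x : X}

/-- The set `B` cuts the open set `U` into two connected open sides `U₁` and `U₂`, both of which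
accumulate at every point of `B` in `U`. -/
structure IsTwoSidedCut (B U U₁ U₂ : Set X) : Prop where
  isOpen : IsOpen U
  isOpen_left : IsOpen U₁
  isOpen_right : IsOpen U₂
  isPreconnected_left : IsPreconnected U₁
  isPreconnected_right : IsPreconnected U₂
  disjoint : Disjoint U₁ U₂
  sdiff_eq : U \ B = U₁ ∪ U₂
  subset_closure_left : U ∩ B ⊆ closure U₁
  subset_closure_right : U ∩ B ⊆ closure U₂

/-- `B` is locally two-sided at `b`: it cuts arbitrarily small neighbourhoods of `b` into two
sides. -/
def TwoSidedAt (B : Set X) (b : X) : Prop :=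
  ∀ W ∈ 𝓝 b, ∃ U U₁ U₂, U ⊆ W ∧ b ∈ U ∧ IsTwoSidedCut B U U₁ U₂

/-- The points of `B` at which `B` is not locally two-sided. -/
def badSet (B : Set X) : Set X := {b ∈ B | ¬TwoSidedAt B b}

/-- `f` behaves at `x` like a function telling apart the two sides of `B`: it is locally constant
off `B`, and takes both values arbitrarily close to each point of `B`. -/
def SepAt (B : Set X) (f : X → ZMod 2) (x : X) : Prop :=
  (x ∉ B → ContinuousAt f x) ∧ (x ∈ B → ∀ c, ∃ᶠ y in 𝓝[Bᶜ] x, f y = c)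

theorem twoSidedAt_of_mem_of_notMem_badSet (hx : x ∈ B) (hx' : x ∉ badSet B) : TwoSidedAt B x :=
  by_contra fun h => hx' ⟨hx, h⟩

theorem compl_subset_compl_badSet : Bᶜ ⊆ (badSet B)ᶜ := compl_subset_compl.2 fun _ hx => hx.1

namespace IsTwoSidedCut

theorem symm (h : IsTwoSidedCut B U U₁ U₂) : IsTwoSidedCut B U U₂ U₁ :=
  ⟨h.isOpen, h.isOpen_right, h.isOpen_left, h.isPreconnected_right, h.isPreconnected_left,
    h.disjoint.symm, h.sdiff_eq.trans (union_comm _ _), h.subset_closure_right,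
    h.subset_closure_left⟩

theorem left_subset (h : IsTwoSidedCut B U U₁ U₂) : U₁ ⊆ U \ B :=
  h.sdiff_eq ▸ subset_union_left

theorem mem_left_or_mem_right (h : IsTwoSidedCut B U U₁ U₂) (hx : x ∈ U) (hxB : x ∉ B) :
    x ∈ U₁ ∨ x ∈ U₂ := by
  rw [← mem_union, ← h.sdiff_eq]
  exact ⟨hx, hxB⟩

theorem eqOn_indicator_right (h : IsTwoSidedCut B U U₁ U₂) :
    EqOn (U₁.indicator (1 : X → ZMod 2)) 0 U₂ :=
  fun _ hx => indicator_of_notMem (disjoint_right.1 h.disjoint hx) _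

theorem frequently_mem_left (h : IsTwoSidedCut B U U₁ U₂) (hx : x ∈ U) (hxB : x ∈ B) :
    ∃ᶠ y in 𝓝[Bᶜ] x, y ∈ U₁ :=
  frequently_nhdsWithin_iff.2 <| (mem_closure_iff_frequently.1
    (h.subset_closure_left ⟨hx, hxB⟩)).mono fun _ hy => ⟨hy, (h.left_subset hy).2⟩

theorem sepAt_indicator (h : IsTwoSidedCut B U U₁ U₂) (hx : x ∈ U) :
    SepAt B (U₁.indicator 1) x := by
  refine ⟨fun hxB => ?_, fun hxB c => ?_⟩
  · obtain hx₁ | hx₂ := h.mem_left_or_mem_right hx hxB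
    · exact (continuousOn_const.congr eqOn_indicator).continuousAt
        (h.isOpen_left.mem_nhds hx₁)
    · exact (continuousOn_const.congr h.eqOn_indicator_right).continuousAt
        (h.isOpen_right.mem_nhds hx₂)
  · obtain rfl | rfl : c = 1 ∨ c = 0 := by revert c; decide
    · exact (h.frequently_mem_left hx hxB).mono eqOn_indicator
    · exact (h.symm.frequently_mem_left hx hxB).mono h.eqOn_indicator_right

theorem exists_forall_left_eq (h : IsTwoSidedCut B U U₁ U₂) (hf : ContinuousOn f (U \ B)) :
    ∃ a, ∀ y ∈ U₁, f y = a := by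
  obtain ⟨a, -, ha⟩ := h.isPreconnected_left.eqOn_const_of_mapsTo
    (isDiscrete_univ_iff.2 inferInstance) (hf.mono h.left_subset) (mapsTo_univ _ _) univ_nonempty
  exact ⟨a, ha⟩

theorem exists_values (h : IsTwoSidedCut B U U₁ U₂) (hxU : x ∈ U) (hxB : x ∈ B)
    (hx : SepAt B f x) (hf : ContinuousOn f (U \ B)) :
    ∃ a, (∀ y ∈ U₁, f y = a + 1) ∧ ∀ y ∈ U₂, f y = a := by
  obtain ⟨a₁, ha₁⟩ := h.exists_forall_left_eq hf
  obtain ⟨a₂, ha₂⟩ := h.symm.exists_forall_left_eq hf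
  have hvalues : ∀ c, c = a₁ ∨ c = a₂ := fun c => by
    obtain ⟨y, hyc, hyU, hyB⟩ := ((hx.2 hxB c).and_eventually
      ((eventually_nhdsWithin_of_eventually_nhds (h.isOpen.eventually_mem hxU)).and
        eventually_mem_nhdsWithin)).exists
    rw [← hyc]
    exact (h.mem_left_or_mem_right hyU hyB).imp (ha₁ y) (ha₂ y)
  have ha : a₁ = a₂ + 1 := by
    clear ha₁ ha₂
    revert a₁ a₂
    decide
  exact ⟨a₂, ha ▸ ha₁, ha₂⟩

theorem inter_preimage_eq_left (h : IsTwoSidedCut B U U₁ U₂) {a₁ a₂ : ZMod 2} (ha : a₁ ≠ a₂)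
    (h₁ : ∀ y ∈ U₁, f y = a₁) (h₂ : ∀ y ∈ U₂, f y = a₂) : U ∩ (Bᶜ ∩ f ⁻¹' {a₁}) = U₁ := by
  refine Subset.antisymm (fun y ⟨hyU, hyB, hya⟩ => ?_)
    fun y hy => ⟨(h.left_subset hy).1, (h.left_subset hy).2, h₁ y hy⟩
  exact (h.mem_left_or_mem_right hyU hyB).resolve_right fun hy => ha (hya.symm.trans (h₂ y hy))

theorem isPreconnected_inter_preimage (h : IsTwoSidedCut B U U₁ U₂) (hxU : x ∈ U) (hxB : x ∈ B)
    (hx : SepAt B f x) (hf : ContinuousOn f (U \ B)) (c : ZMod 2) :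
    IsPreconnected (U ∩ (Bᶜ ∩ f ⁻¹' {c})) := by
  obtain ⟨a, ha₁, ha₂⟩ := h.exists_values hxU hxB hx hf
  obtain rfl | rfl : c = a + 1 ∨ c = a := by
    clear ha₁ ha₂
    revert a c
    decide
  · rw [h.inter_preimage_eq_left (by simp) ha₁ ha₂]
    exact h.isPreconnected_left
  · rw [h.symm.inter_preimage_eq_left (by simp) ha₂ ha₁]
    exact h.isPreconnected_right

end IsTwoSidedCut

theorem SepAt.of_eqModConstAt (hB : IsClosed B) (hfg : EqModConstAt Bᶜ f g x)
    (hg : SepAt B g x) : SepAt B f x := by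
  obtain ⟨a, ha⟩ := eventuallyConst_iff_exists_eventuallyEq.1 hfg
  have hfa : f =ᶠ[𝓝[Bᶜ] x] fun y => a + g y := ha.mono fun y hy => sub_eq_iff_eq_add.1 hy
  refine ⟨fun hx => ?_, fun hx c => ?_⟩
  · rw [hB.isOpen_compl.nhdsWithin_eq hx] at hfa
    exact (continuousAt_const.add (hg.1 hx)).congr hfa.symm
  · refine ((hg.2 hx (c - a)).and_eventually hfa).mono fun y hy => ?_
    simp only [hy.2, hy.1, add_sub_cancel]

theorem SepAt.eqModConstAt (hx : x ∉ badSet B) (hf : ∀ᶠ y in 𝓝 x, SepAt B f y)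
    (hg : ∀ᶠ y in 𝓝 x, SepAt B g y) : EqModConstAt Bᶜ f g x := by
  by_cases hxB : x ∈ B
  · obtain ⟨U, U₁, U₂, hU, hxU, hcut⟩ :=
      twoSidedAt_of_mem_of_notMem_badSet hxB hx _ (hf.and hg)
    have hcont : ∀ {p : X → ZMod 2}, (∀ y ∈ U, SepAt B p y) → ContinuousOn p (U \ B) :=
      fun hp y hy => ((hp y hy.1).1 hy.2).continuousWithinAt
    obtain ⟨a, ha₁, ha₂⟩ := hcut.exists_values hxU hxB hf.self_of_nhds (hcont fun y hy => (hU hy).1)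
    obtain ⟨b, hb₁, hb₂⟩ := hcut.exists_values hxU hxB hg.self_of_nhds (hcont fun y hy => (hU hy).2)
    refine eventuallyConst_iff_exists_eventuallyEq.2 ⟨a - b, ?_⟩
    filter_upwards [mem_nhdsWithin_of_mem_nhds (hcut.isOpen.mem_nhds hxU), self_mem_nhdsWithin]
      with y hyU hyB
    obtain hy | hy := hcut.mem_left_or_mem_right hyU hyB
    · rw [Pi.sub_apply, ha₁ y hy, hb₁ y hy, add_sub_add_right_eq_sub]
    · rw [Pi.sub_apply, ha₂ y hy, hb₂ y hy]
  · exact eventuallyConst_of_continuousWithinAt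
      ((hf.self_of_nhds.1 hxB).sub (hg.self_of_nhds.1 hxB)).continuousWithinAt

theorem exists_eventually_sepAt (hB : IsClosed B) (hx : x ∉ badSet B) :
    ∃ f, ∀ᶠ y in 𝓝 x, SepAt B f y := by
  by_cases hxB : x ∈ B
  · obtain ⟨U, U₁, U₂, -, hxU, hcut⟩ :=
      twoSidedAt_of_mem_of_notMem_badSet hxB hx univ univ_mem
    exact ⟨U₁.indicator 1, (hcut.isOpen.eventually_mem hxU).mono fun y => hcut.sepAt_indicator⟩
  · exact ⟨0, (hB.isOpen_compl.eventually_mem hxB).mono fun y hy =>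
      ⟨fun _ => continuousAt_const, fun hyB => absurd hyB hy⟩⟩

theorem dense_compl_of_dense_compl_badSet (h : Dense (badSet B)ᶜ) : Dense Bᶜ := by
  refine dense_closure.1 (h.mono fun x hx => ?_)
  by_cases hxB : x ∈ B
  · obtain ⟨U, U₁, U₂, -, hxU, hcut⟩ :=
      twoSidedAt_of_mem_of_notMem_badSet hxB hx univ univ_mem
    exact closure_mono (fun y hy => (hcut.left_subset hy).2) (hcut.subset_closure_left ⟨hxU, hxB⟩)
  · exact subset_closure hxB

theorem exists_forall_sepAt [SimplyConnectedSpace X] [LocallyPathConnectedSpace X]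
    (hB : IsClosed B) (hdense : Dense (badSet B)ᶜ)
    (hK : ∀ x, LocallyNonseparatingAt (badSet B) x)
    (hT : ∀ x ∈ badSet B, ∃ T : Set X, IsOpen T ∧ Disjoint T (badSet B) ∧
      SimplyConnectedSpace T ∧ ∀ᶠ y in 𝓝 x, y ∈ closure T ∧ LocallyNonseparatingAt Tᶜ y) :
    ∃ f, ∀ x ∉ badSet B, SepAt B f x := by
  choose! p hp using fun x (hx : x ∉ badSet B) => exists_eventually_sepAt hB hx
  obtain ⟨F, hF⟩ := exists_eqModConstAt_of_locallyNonseparatingAt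
    (dense_compl_of_dense_compl_badSet hdense)
    (disjoint_left.2 fun _ h => compl_subset_compl_badSet h)
    (fun x hx => (eventually_eventually_nhds.2 (hp x hx)).mono fun y hy hyK =>
      SepAt.eqModConstAt hyK hy (hp y hyK)) hK hT
  exact ⟨F, fun x hx => .of_eqModConstAt hB (hF x hx) (hp x hx).self_of_nhds⟩

end TwoSided

section Counting

variable {X : Type*} [TopologicalSpace X]

theorem isPreconnected_of_inter_frontier {Y S : Set X} (hY : IsPreconnected Y) (hS : IsOpen S)
    (hSY : S ⊆ Y) (hfr : IsPreconnected (Y ∩ frontier S))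
    (hloc : ∀ b ∈ Y ∩ frontier S, ∃ V ∈ 𝓝 b, IsPreconnected (V ∩ S)) : IsPreconnected S := by
  refine isPreconnected_of_forall_constant fun g hg x hx y hy => ?_
  have hconst : ∀ b ∈ Y ∩ frontier S, EventuallyConst g (𝓝[S] b) := fun b hb => by
    obtain ⟨V, hV, hVS⟩ := hloc b hb
    obtain ⟨z, hz, hzV⟩ := mem_closure_iff_nhds.1 hb.2.1 V hV
    refine eventuallyConst_iff_exists_eventuallyEq.2 ⟨g z, ?_⟩
    filter_upwards [mem_nhdsWithin_of_mem_nhds hV, self_mem_nhdsWithin] with w hwV hwS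
    exact hVS.constant (hg.mono inter_subset_right) ⟨hwV, hwS⟩ ⟨hz, hzV⟩
  obtain ⟨a, ha⟩ := exists_forall_eventually_eq_of_isPreconnected hfr
    (fun b hb => frontier_subset_closure hb.2) hconst
  classical
  have hnotMem : ∀ b ∈ Y ∩ frontier S, S.piecewise g (fun _ => a) b = a := fun b hb =>
    piecewise_eq_of_notMem _ _ _ (hS.frontier_eq ▸ hb.2).2
  have hcont : ContinuousOn (S.piecewise g fun _ => a) Y := by
    refine ContinuousOn.piecewise' (fun b hb => ?_) (fun b hb => ?_) (hg.mono inter_subset_right)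
      continuousOn_const
    · rw [hnotMem b hb]
      exact tendsto_const_nhds.congr' <|
        ((ha b hb).filter_mono (nhdsWithin_mono _ inter_subset_right)).mono fun _ => Eq.symm
    · rw [hnotMem b hb]
      exact tendsto_const_nhds
  simpa only [piecewise_eq_of_mem _ _ _ hx, piecewise_eq_of_mem _ _ _ hy] using
    hY.constant hcont (hSY hx) (hSY hy)

section Fiber

variable {B : Set X} {f : X → ZMod 2} (hB : IsClosed B) (hf : ∀ x ∉ badSet B, SepAt B f x)
  (c : ZMod 2)

include hf

theorem continuousOn_compl_of_sepAt : ContinuousOn f Bᶜ := fun x hx =>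
  ((hf x (compl_subset_compl_badSet hx)).1 hx).continuousWithinAt

theorem sdiff_badSet_subset_closure : B \ badSet B ⊆ closure (Bᶜ ∩ f ⁻¹' {c}) := fun x hx =>
  mem_closure_iff_frequently.2 <| (frequently_nhdsWithin_iff.1 ((hf x hx.2).2 hx.1 c)).mono
    fun _ hy => hy.symm

include hB

theorem isOpen_compl_inter_preimage : IsOpen (Bᶜ ∩ f ⁻¹' {c}) :=
  (continuousOn_compl_of_sepAt hf).isOpen_inter_preimage hB.isOpen_compl (isOpen_discrete _)

theorem compl_badSet_inter_frontier :
    (badSet B)ᶜ ∩ frontier (Bᶜ ∩ f ⁻¹' {c}) = B \ badSet B := by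
  rw [(isOpen_compl_inter_preimage hB hf c).frontier_eq]
  refine Subset.antisymm (fun x ⟨hxK, hxcl, hxS⟩ => ⟨by_contra fun hxB => hxS ⟨hxB, ?_⟩, hxK⟩)
    fun x hx => ⟨hx.2, sdiff_badSet_subset_closure hf c hx, fun h => h.1 hx.1⟩
  have hnear : ∀ᶠ y in 𝓝 x, f y = f x := by
    simpa only [nhds_discrete, tendsto_pure] using ((hf x hxK).1 hxB).tendsto
  obtain ⟨y, hy, hyx⟩ := ((mem_closure_iff_frequently.1 hxcl).and_eventually hnear).exists
  exact hyx.symm.trans hy.2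

theorem isConnected_compl_inter_preimage (hK : IsPreconnected (badSet B)ᶜ)
    (hBK : IsConnected (B \ badSet B)) : IsConnected (Bᶜ ∩ f ⁻¹' {c}) := by
  have hfr := compl_badSet_inter_frontier hB hf c
  refine ⟨closure_nonempty_iff.1 (hBK.nonempty.mono (sdiff_badSet_subset_closure hf c)),
    isPreconnected_of_inter_frontier hK (isOpen_compl_inter_preimage hB hf c)
      (inter_subset_left.trans compl_subset_compl_badSet) (hfr ▸ hBK.isPreconnected) ?_⟩
  rw [hfr]
  intro b hb
  obtain ⟨U, U₁, U₂, -, hbU, hcut⟩ :=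
    twoSidedAt_of_mem_of_notMem_badSet hb.1 hb.2 univ univ_mem
  exact ⟨U, hcut.isOpen.mem_nhds hbU, hcut.isPreconnected_inter_preimage hbU hb.1 (hf b hb.2)
    ((continuousOn_compl_of_sepAt hf).mono fun y hy => hy.2) c⟩

end Fiber

theorem card_connectedComponents_of_isInducing {Z α : Type*} [TopologicalSpace Z]
    [TopologicalSpace α] [TotallyDisconnectedSpace α] {ι : Z → X} (hι : IsInducing ι) {φ : X → α}
    (hφ : ContinuousOn φ (range ι)) (h : ∀ c, IsConnected (range ι ∩ φ ⁻¹' {c})) :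
    Nat.card (ConnectedComponents Z) = Nat.card α := by
  have hcont : Continuous (φ ∘ ι) := hφ.comp_continuous hι.continuous mem_range_self
  refine Nat.card_congr (Equiv.ofBijective hcont.connectedComponentsLift ⟨?_, fun c => ?_⟩)
  · refine ConnectedComponents.surjective_coe.forall₂.2 fun y z hyz => ?_
    simp only [Continuous.connectedComponentsLift_apply_coe, Function.comp_apply] at hyz
    have hpre : IsPreconnected (ι ⁻¹' (range ι ∩ φ ⁻¹' {φ (ι z)})) := by
      rw [← hι.isPreconnected_image, image_preimage_eq_of_subset inter_subset_left]
      exact (h _).isPreconnected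
    exact ConnectedComponents.coe_eq_coe.2 <| connectedComponent_eq <|
      hpre.subset_connectedComponent ⟨mem_range_self y, hyz⟩ ⟨mem_range_self z, rfl⟩
  · obtain ⟨_, ⟨z, rfl⟩, hz⟩ := (h c).nonempty
    exact ⟨z, hz⟩

end Counting

section Thin

open Module

variable {E : Type*} [NormedAddCommGroup E] [NormedSpace ℝ E] {c : ℕ} {S S' U : Set E}

/-- `S` lies in a finite union of affine subspaces of codimension at least `c`: the usual
smallness condition for exceptional sets in general position arguments. -/
def IsThin (c : ℕ) (S : Set E) : Prop :=
  ∃ 𝓐 : Set (AffineSubspace ℝ E), 𝓐.Finite ∧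
    (∀ A ∈ 𝓐, finrank ℝ A.direction + c ≤ finrank ℝ E) ∧ S ⊆ ⋃ A ∈ 𝓐, (A : Set E)

theorem IsThin.mono (h : IsThin c S) (hS : S' ⊆ S) : IsThin c S' := by
  obtain ⟨𝓐, hfin, hdim, hsub⟩ := h
  exact ⟨𝓐, hfin, hdim, hS.trans hsub⟩

theorem IsThin.of_le {c' : ℕ} (h : IsThin c S) (hc : c' ≤ c) : IsThin c' S := by
  obtain ⟨𝓐, hfin, hdim, hsub⟩ := h
  exact ⟨𝓐, hfin, fun A hA => (Nat.add_le_add_left hc _).trans (hdim A hA), hsub⟩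

theorem isThin_affineSubspace {A : AffineSubspace ℝ E}
    (hA : finrank ℝ A.direction + c ≤ finrank ℝ E) : IsThin c (A : Set E) :=
  ⟨{A}, finite_singleton A, by simpa using hA, by simp⟩

theorem isThin_biUnion {ι : Type*} {s : Set ι} (hs : s.Finite) {T : ι → Set E}
    (h : ∀ i ∈ s, IsThin c (T i)) : IsThin c (⋃ i ∈ s, T i) := by
  choose! 𝓐 hfin hdim hsub using h
  refine ⟨⋃ i ∈ s, 𝓐 i, hs.biUnion hfin, fun A hA => ?_, iUnion₂_subset fun i hi => ?_⟩
  · obtain ⟨i, hi, hA⟩ := mem_iUnion₂.1 hA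
    exact hdim i hi A hA
  · exact (hsub i hi).trans (biUnion_subset_biUnion_left (subset_biUnion_of_mem hi))

theorem isThin_empty : IsThin c (∅ : Set E) :=
  ⟨∅, finite_empty, by simp, by simp⟩

theorem IsThin.union (h : IsThin c S) (h' : IsThin c S') : IsThin c (S ∪ S') := by
  simpa [union_eq_iUnion] using
    isThin_biUnion (T := fun b => cond b S S') finite_univ (by rintro (_ | _) - <;> simpa)

theorem IsThin.image {F : Type*} [NormedAddCommGroup F] [NormedSpace ℝ F] [FiniteDimensional ℝ E]
    (h : IsThin c S) (α : E →ᵃ[ℝ] F) {d : ℕ} (hd : finrank ℝ F = finrank ℝ E + d) :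
    IsThin (c + d) (α '' S) := by
  obtain ⟨𝓐, hfin, hdim, hsub⟩ := h
  refine ⟨AffineSubspace.map α '' 𝓐, hfin.image _, ?_, ?_⟩
  · rintro _ ⟨A, hA, rfl⟩
    have hle := Submodule.finrank_map_le α.linear A.direction
    have := hdim A hA
    rw [AffineSubspace.map_direction]
    omega
  · rintro _ ⟨x, hx, rfl⟩
    obtain ⟨A, hA, hx⟩ := mem_iUnion₂.1 (hsub hx)
    exact mem_iUnion₂.2 ⟨_, mem_image_of_mem _ hA, mem_image_of_mem α hx⟩

theorem IsThin.lineMap_preimage (h : IsThin (c + 1) S) {z : E} (hz : z ∉ S) :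
    IsThin c {p | ∃ s : ℝ, AffineMap.lineMap z p s ∈ S} := by
  obtain ⟨𝓐, hfin, hdim, hsub⟩ := h
  refine ⟨(fun A : AffineSubspace ℝ E => affineSpan ℝ (insert z (A : Set E))) '' 𝓐, hfin.image _,
    ?_, ?_⟩
  · rintro _ ⟨A, hA, rfl⟩
    have hle := finrank_vectorSpan_insert_le A z
    have := hdim A hA
    rw [direction_affineSpan]
    omega
  · rintro p ⟨s, hs⟩
    obtain ⟨A, hA, hsA⟩ := mem_iUnion₂.1 (hsub hs)
    have hs0 : s ≠ 0 := by
      rintro rfl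
      exact hz (by simpa using hs)
    have hp : AffineMap.lineMap z (AffineMap.lineMap z p s : E) s⁻¹ = p := by
      simp [AffineMap.lineMap_apply, smul_smul, inv_mul_cancel₀ hs0]
    refine mem_iUnion₂.2 ⟨_, mem_image_of_mem _ hA, hp ▸ AffineMap.lineMap_mem _ ?_ ?_⟩
    · exact subset_affineSpan ℝ _ (mem_insert z _)
    · exact subset_affineSpan ℝ _ (mem_insert_of_mem z hsA)

theorem isClosed_setOf_exists_lineMap_mem {C : Set E} (hC : IsClosed C) (z : E) :
    IsClosed {p | ∃ s : unitInterval, AffineMap.lineMap z p (s : ℝ) ∈ C} := by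
  have himage : {p | ∃ s : unitInterval, AffineMap.lineMap z p (s : ℝ) ∈ C} =
      Prod.snd '' {q : unitInterval × E | AffineMap.lineMap z q.2 (q.1 : ℝ) ∈ C} := by
    ext p
    simp
  rw [himage]
  refine isClosedMap_snd_of_compactSpace _ (hC.preimage ?_)
  simp only [AffineMap.lineMap_apply]
  fun_prop

variable [FiniteDimensional ℝ E]

theorem IsThin.exists_isClosed (h : IsThin c S) : ∃ C, IsClosed C ∧ S ⊆ C ∧ IsThin c C := by
  obtain ⟨𝓐, hfin, hdim, hsub⟩ := h
  exact ⟨_, hfin.isClosed_biUnion fun A _ => A.closed_of_finiteDimensional, hsub,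
    𝓐, hfin, hdim, subset_rfl⟩

theorem IsThin.dense_compl (h : IsThin 1 S) : Dense Sᶜ := by
  borelize E
  obtain ⟨𝓐, hfin, hdim, hsub⟩ := h
  let μ := (Module.finBasis ℝ E).addHaar
  have hA : ∀ A ∈ 𝓐, μ (A : Set E) = 0 := by
    refine fun A hA => MeasureTheory.Measure.addHaar_affineSubspace _ A ?_
    rintro rfl
    have := hdim _ hA
    rw [AffineSubspace.direction_top, finrank_top] at this
    omega
  have hS : μ S = 0 := MeasureTheory.measure_mono_null hsub
    ((MeasureTheory.measure_biUnion_null_iff hfin.countable).2 hA)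
  exact MeasureTheory.Measure.dense_of_ae (μ := μ) (by simpa [MeasureTheory.ae_iff] using hS)

theorem IsThin.isPreconnected_sdiff (h : IsThin 2 S) (hU : IsOpen U) (hUc : Convex ℝ U) :
    IsPreconnected (U \ S) := by
  refine isPreconnected_of_forall_pair ?_
  rintro p ⟨hpU, hpS⟩ q ⟨hqU, hqS⟩
  obtain ⟨w, hw, hwU⟩ := ((h.lineMap_preimage (c := 1) hpS).union
    (h.lineMap_preimage (c := 1) hqS)).dense_compl.exists_mem_open hU ⟨p, hpU⟩
  have hseg : ∀ r ∈ U, (∀ s : ℝ, AffineMap.lineMap r w s ∉ S) → segment ℝ r w ⊆ U \ S := by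
    refine fun r hr hrs y hy => ⟨hUc.segment_subset hr hwU hy, ?_⟩
    rw [segment_eq_image_lineMap] at hy
    obtain ⟨s, -, rfl⟩ := hy
    exact hrs s
  exact ⟨segment ℝ p w ∪ segment ℝ q w,
    union_subset (hseg p hpU fun s hs => hw (.inl ⟨s, hs⟩))
      (hseg q hqU fun s hs => hw (.inr ⟨s, hs⟩)),
    .inl (left_mem_segment ℝ p w), .inr (left_mem_segment ℝ q w),
    .union w (right_mem_segment ℝ p w) (right_mem_segment ℝ q w)
      (convex_segment p w).isPreconnected (convex_segment q w).isPreconnected⟩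

/-- Remove from `U` the shadow cast by `S` when it is lit from a point in general position. -/
theorem IsThin.exists_starConvex (h : IsThin (c + 2) S) (hU : IsOpen U) (hUc : Convex ℝ U)
    (hUne : U.Nonempty) :
    ∃ T ⊆ U, IsOpen T ∧ Disjoint T S ∧ (∃ z ∈ T, StarConvex ℝ z T) ∧ IsThin (c + 1) (U \ T) := by
  obtain ⟨C, hC, hSC, hCt⟩ := h.exists_isClosed
  obtain ⟨z, hzC, hzU⟩ :=
    (hCt.of_le (by omega : 1 ≤ c + 2)).dense_compl.exists_mem_open hU hUne
  let R : Set E := {p | ∃ s : unitInterval, AffineMap.lineMap z p (s : ℝ) ∈ C}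
  refine ⟨U \ R, sdiff_subset, hU.sdiff (isClosed_setOf_exists_lineMap_mem hC z), ?_,
    ⟨z, ⟨hzU, ?_⟩, ?_⟩, ?_⟩
  · exact disjoint_left.2 fun p hp hpS => hp.2 ⟨1, by simpa using hSC hpS⟩
  · rintro ⟨s, hs⟩
    exact hzC (by simpa using hs)
  · rintro p ⟨hpU, hpR⟩ a b ha hb hab
    refine ⟨hUc hzU hpU ha hb hab, ?_⟩
    have hlineMap : a • z + b • p = AffineMap.lineMap z p b := by
      simp [AffineMap.lineMap_apply_module, ← hab]
    rintro ⟨s, hs⟩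
    rw [hlineMap, AffineMap.lineMap_lineMap_right] at hs
    exact hpR ⟨⟨_, mul_nonneg s.2.1 hb, mul_le_one₀ s.2.2 hb (by linarith)⟩, hs⟩
  · refine (hCt.lineMap_preimage hzC).mono ?_
    rw [sdiff_sdiff_right_self]
    rintro p ⟨-, s, hs⟩
    exact ⟨s, hs⟩

theorem isThin_inter_of_ne {A A' : AffineSubspace ℝ E}
    (hA : finrank ℝ A.direction + c ≤ finrank ℝ E) (hA' : finrank ℝ A'.direction + c ≤ finrank ℝ E)
    (hne : A ≠ A') : IsThin (c + 1) (A ∩ A' : Set E) := by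
  obtain hempty | hnonempty := (A ∩ A' : Set E).eq_empty_or_nonempty
  · exact hempty ▸ isThin_empty
  wlog hlt : A ⊓ A' < A generalizing A A'
  · rw [inter_comm] at hnonempty ⊢
    refine this hA' hA hne.symm hnonempty (inf_le_left.lt_of_ne fun h => hlt ?_)
    exact inf_le_left.lt_of_ne fun h' => hne ((inf_eq_left.1 h').antisymm (inf_eq_left.1 h))
  have hdim := Submodule.finrank_lt_finrank_of_lt
    (AffineSubspace.direction_lt_of_nonempty hlt hnonempty)
  exact isThin_affineSubspace (A := A ⊓ A') (by omega)

theorem IsThin.exists_locally_subset_affineSubspace (h : IsThin c S) :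
    ∃ T, IsThin (c + 1) T ∧ ∀ q ∉ T, (∀ᶠ x in 𝓝 q, x ∉ S) ∨
      ∃ A : AffineSubspace ℝ E, q ∈ A ∧ finrank ℝ A.direction + c ≤ finrank ℝ E ∧
        ∀ᶠ x in 𝓝 q, x ∈ S → x ∈ A := by
  obtain ⟨𝓐, hfin, hdim, hsub⟩ := h
  refine ⟨⋃ p ∈ 𝓐.offDiag, (p.1 ∩ p.2 : Set E),
    isThin_biUnion hfin.offDiag fun p hp => isThin_inter_of_ne (hdim _ hp.1) (hdim _ hp.2.1) hp.2.2,
    fun q hq => ?_⟩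
  have hnear : ∀ᶠ x in 𝓝 q, ∀ A ∈ 𝓐, x ∈ A → q ∈ A := by
    refine (eventually_all_finite hfin).2 fun A _ => ?_
    by_cases hqA : q ∈ A
    · exact .of_forall fun _ _ => hqA
    · filter_upwards [A.closed_of_finiteDimensional.isOpen_compl.mem_nhds hqA] with x hx hxA
      exact absurd hxA hx
  by_cases hex : ∃ A ∈ 𝓐, q ∈ A
  · obtain ⟨A, hA, hqA⟩ := hex
    refine .inr ⟨A, hqA, hdim A hA, hnear.mono fun x hx hxS => ?_⟩
    obtain ⟨A', hA', hxA'⟩ := mem_iUnion₂.1 (hsub hxS)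
    obtain rfl : A = A' := by
      by_contra hne
      exact hq (mem_iUnion₂.2 ⟨(A, A'), ⟨hA, hA', hne⟩, hqA, hx A' hA' hxA'⟩)
    exact hxA'
  · refine .inl (hnear.mono fun x hx hxS => hex ?_)
    obtain ⟨A, hA, hxA⟩ := mem_iUnion₂.1 (hsub hxS)
    exact ⟨A, hA, hx A hA hxA⟩

end Thin

section Polyhedral

open Module

variable {E F : Type*} [NormedAddCommGroup E] [NormedSpace ℝ E] [NormedAddCommGroup F]
  [NormedSpace ℝ F]

theorem exists_pos_lineMap_mem_convexHull {ι : Type*} [Fintype ι] {z : ι → E} {w : ι → ℝ}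
    (hw : ∀ i, 0 < w i) (hw1 : ∑ i, w i = 1) {p : E} (hp : p ∈ affineSpan ℝ (range z)) :
    ∃ ε > (0 : ℝ), AffineMap.lineMap (∑ i, w i • z i) p ε ∈ convexHull ℝ (range z) := by
  obtain ⟨v, hv1, rfl⟩ := eq_affineCombination_of_mem_affineSpan_of_fintype hp
  rw [Finset.affineCombination_eq_linear_combination _ _ _ hv1]
  have hweights : ∀ᶠ ε in 𝓝[>] (0 : ℝ), ∀ i, 0 < AffineMap.lineMap (w i) (v i) ε := by
    refine eventually_all.2 fun i => Eventually.filter_mono nhdsWithin_le_nhds ?_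
    exact AffineMap.lineMap_continuous.continuousAt.eventually (lt_mem_nhds (by simpa using hw i))
  obtain ⟨ε, hε, hε0⟩ := (hweights.and self_mem_nhdsWithin).exists
  refine ⟨ε, hε0, ?_⟩
  have hcomb : AffineMap.lineMap (∑ i, w i • z i) (∑ i, v i • z i) ε
      = ∑ i, (AffineMap.lineMap (w i) (v i) ε : ℝ) • z i := by
    simp only [AffineMap.lineMap_apply_module, Finset.smul_sum, smul_smul,
      ← Finset.sum_add_distrib, smul_eq_mul, add_smul]
  have hsum : ∑ i, (AffineMap.lineMap (w i) (v i) ε : ℝ) = 1 := by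
    simp only [AffineMap.lineMap_apply_module, smul_eq_mul, Finset.sum_add_distrib,
      ← Finset.mul_sum, hw1, hv1, mul_one, sub_add_cancel]
  exact hcomb ▸ (convex_convexHull ℝ _).sum_mem (fun i _ => (hε i).le) hsum
    fun i _ => subset_convexHull ℝ _ (mem_range_self i)

variable [FiniteDimensional ℝ F]

theorem mem_interior_of_forall_exists_lineMap_mem {S : Set F} (hS : Convex ℝ S) {q : F}
    (hq : q ∈ S) (h : ∀ z, ∃ ε > (0 : ℝ), AffineMap.lineMap q z ε ∈ S) : q ∈ interior S := by
  have hspan : affineSpan ℝ S = ⊤ := by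
    refine eq_top_iff.2 fun z _ => ?_
    obtain ⟨ε, hε, hz⟩ := h z
    have hline : AffineMap.lineMap q (AffineMap.lineMap q z ε : F) ε⁻¹ = z := by
      simp [AffineMap.lineMap_apply, smul_smul, inv_mul_cancel₀ hε.ne']
    exact hline ▸ AffineMap.lineMap_mem _ (subset_affineSpan ℝ S hq) (subset_affineSpan ℝ S hz)
  obtain ⟨z, hz⟩ := hS.interior_nonempty_iff_affineSpan_eq_top.2 hspan
  -- `q` lies between the interior point `z` and a point of `S` on the far side of `q`.
  obtain ⟨ε, hε, hεS⟩ := h (q + (q - z))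
  refine hS.openSegment_interior_self_subset_interior hz hεS
    ⟨ε / (1 + ε), 1 / (1 + ε), by positivity, by positivity, by field_simp; ring, ?_⟩
  rw [AffineMap.lineMap_apply, vsub_eq_sub, vadd_eq_add, add_sub_cancel_left]
  match_scalars <;> field_simp <;> ring

theorem isThin_frontier_preimage_convexHull (a : F →ᵃ[ℝ] E) {s : Set E} (hs : s.Finite) :
    IsThin 1 (frontier (a ⁻¹' convexHull ℝ s)) := by
  have hconv : Convex ℝ (a ⁻¹' convexHull ℝ s) := (convex_convexHull ℝ s).affine_preimage a
  refine ⟨{A ∈ (fun T => (affineSpan ℝ T).comap a) '' 𝒫 s |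
    finrank ℝ A.direction + 1 ≤ finrank ℝ F}, (hs.finite_subsets.image _).subset (sep_subset _ _),
    fun A hA => hA.2, ?_⟩
  rw [((hs.isClosed_convexHull ℝ).preimage a.continuous_of_finiteDimensional).frontier_eq]
  rintro q ⟨hqS, hqi⟩
  obtain ⟨ι, _, z, w, hzs, -, hw, hw1, hwq⟩ := eq_pos_convex_span_of_mem_convexHull hqS
  have hqA : q ∈ (affineSpan ℝ (range z)).comap a := by
    rw [AffineSubspace.mem_comap, ← hwq]
    exact convexHull_subset_affineSpan _ ((convex_convexHull ℝ _).sum_mem (fun i _ => (hw i).le) hw1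
      fun i _ => subset_convexHull ℝ _ (mem_range_self i))
  refine mem_iUnion₂.2 ⟨_, ⟨mem_image_of_mem _ hzs, Submodule.finrank_lt fun htop => hqi ?_⟩, hqA⟩
  rw [AffineSubspace.direction_eq_top_iff_of_nonempty ⟨q, hqA⟩] at htop
  refine mem_interior_of_forall_exists_lineMap_mem hconv hqS fun p => ?_
  have hp : p ∈ (affineSpan ℝ (range z)).comap a := htop ▸ AffineSubspace.mem_top ℝ F p
  obtain ⟨ε, hε, hεz⟩ := exists_pos_lineMap_mem_convexHull hw hw1 (AffineSubspace.mem_comap.1 hp)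
  rw [hwq] at hεz
  exact ⟨ε, hε, by simpa only [mem_preimage, AffineMap.apply_lineMap] using convexHull_mono hzs hεz⟩

end Polyhedral

section BentMap

open Module

variable {E F : Type*} [NormedAddCommGroup E] [NormedSpace ℝ E] [NormedAddCommGroup F]
  [NormedSpace ℝ F] {A : F →ₗ[ℝ] E} {ℓ : F →ₗ[ℝ] ℝ} {u v : E}

/-- The linear map `A`, bent along the kernel of `ℓ`: it is linear on each of the half-spaces
`0 ≤ ℓ z` and `ℓ z ≤ 0`. -/
def bentMap (A : F →ₗ[ℝ] E) (ℓ : F →ₗ[ℝ] ℝ) (v : E) (z : F) : E := A z + |ℓ z| • v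

/-- `φ` is a translate of a bent map near `q`. -/
def IsBentAt (φ : F → E) (q : F) : Prop :=
  ∃ A ℓ v, ∀ᶠ x in 𝓝 q, φ x = φ q + bentMap A ℓ v (x - q)

/-- Near `b`, the set `S` consists of at most two half-hyperplanes with the same edge through `b`.
The vector `w` in the definition says that `s` and `t` are neither zero nor negative multiples of
each other. -/
def IsBentHyperplaneAt (S : Set E) (b : E) : Prop :=
  ∃ s t : E →ₗ[ℝ] ℝ, (∃ w, 0 < s w ∧ 0 < t w) ∧
    ∀ᶠ y in 𝓝 b, (y ∈ S ↔ min (s (y - b)) (t (y - b)) = 0)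

@[simp]
theorem bentMap_zero : bentMap A ℓ v 0 = 0 := by simp [bentMap]

theorem bentMap_smul {c : ℝ} (hc : 0 ≤ c) (z : F) :
    bentMap A ℓ v (c • z) = c • bentMap A ℓ v z := by
  simp only [bentMap, map_smul, smul_eq_mul, abs_mul, abs_of_nonneg hc]
  module

theorem exists_bentMap_eq_of_eqOn_ker {A₁ A₂ : F →ₗ[ℝ] E} (h : ∀ z, ℓ z = 0 → A₁ z = A₂ z) :
    ∃ A v, ∀ z, (0 ≤ ℓ z → bentMap A ℓ v z = A₁ z) ∧ (ℓ z ≤ 0 → bentMap A ℓ v z = A₂ z) := by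
  obtain ⟨d, hd⟩ : ∃ d : E, ∀ z, A₁ z = A₂ z + ℓ z • d := by
    by_cases hℓ : ∀ z, ℓ z = 0
    · exact ⟨0, fun z => by simp [h z (hℓ z)]⟩
    obtain ⟨u, hu⟩ := not_forall.1 hℓ
    refine ⟨(ℓ u)⁻¹ • (A₁ u - A₂ u), fun z => ?_⟩
    have hker := h (z - (ℓ z / ℓ u) • u) (by simp [hu])
    simp only [map_sub, map_smul, sub_eq_iff_eq_add] at hker
    rw [hker]
    module
  refine ⟨A₂ + (1 / 2 : ℝ) • ℓ.smulRight d, (1 / 2 : ℝ) • d, fun z => ⟨fun hz => ?_, fun hz => ?_⟩⟩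
  · simp only [bentMap, hd, abs_of_nonneg hz, LinearMap.add_apply, LinearMap.smul_apply,
      LinearMap.smulRight_apply]
    module
  · simp only [bentMap, abs_of_nonpos hz, LinearMap.add_apply, LinearMap.smul_apply,
      LinearMap.smulRight_apply]
    module

theorem IsBentAt.congr {φ ψ : F → E} {q : F} (h : IsBentAt ψ q) (hφ : φ =ᶠ[𝓝 q] ψ) :
    IsBentAt φ q := by
  obtain ⟨A, ℓ, v, h⟩ := h
  exact ⟨A, ℓ, v, by filter_upwards [hφ, h] with x hx hx' using by rw [hx, hx', hφ.eq_of_nhds]⟩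

theorem injective_bentMap_of_injOn {V : Set F} (hV : V ∈ 𝓝 0) (h : InjOn (bentMap A ℓ v) V) :
    Function.Injective (bentMap A ℓ v) := by
  intro z z' hzz'
  have hsmall : ∀ x : F, ∀ᶠ c : ℝ in 𝓝[>] 0, c • x ∈ V := fun x =>
    ((continuous_id.smul continuous_const).tendsto' (0 : ℝ) (0 : F) (zero_smul ℝ x)
      |>.mono_left nhdsWithin_le_nhds).eventually hV
  obtain ⟨c, ⟨hz, hz'⟩, hc⟩ := (((hsmall z).and (hsmall z')).and self_mem_nhdsWithin).exists
  have hc0 : (0 : ℝ) < c := hc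
  refine smul_right_injective F hc0.ne' (h hz hz' ?_)
  simp only [bentMap_smul hc0.le, hzz']

theorem injective_of_injective_bentMap (h : Function.Injective (bentMap A ℓ v)) :
    Function.Injective A := by
  have := IsAddTorsionFree.of_isTorsionFree ℝ F
  refine (injective_iff_map_eq_zero A).2 fun z hz => self_eq_neg.1 (h ?_)
  simp [bentMap, hz]

theorem bentMap_apply_eq {z₀ : F} (z : F) :
    bentMap A ℓ (A z₀) z = A (z + |ℓ z| • z₀) := by
  simp [bentMap]

theorem abs_lt_one_of_injective_bentMap {z₀ : F} (h : Function.Injective (bentMap A ℓ (A z₀))) :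
    |ℓ z₀| < 1 := by
  by_contra! hκ
  -- Otherwise `-z₀` and a nonnegative multiple of `z₀` have the same image.
  have hr : 0 ≤ (|ℓ z₀| - 1) / (|ℓ z₀| + 1) := div_nonneg (by linarith) (by positivity)
  have hcollide : -z₀ = ((|ℓ z₀| - 1) / (|ℓ z₀| + 1)) • z₀ := by
    apply h
    simp only [bentMap_apply_eq, map_neg, map_smul, smul_eq_mul, abs_neg, abs_mul, abs_of_nonneg hr]
    congr 1
    match_scalars
    field_simp
    ring
  have hz₀ : z₀ = 0 := by
    have hzero : ((|ℓ z₀| - 1) / (|ℓ z₀| + 1) + 1) • z₀ = 0 := by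
      rw [add_smul, one_smul, ← hcollide, neg_add_cancel]
    exact (smul_eq_zero.1 hzero).resolve_left (by positivity)
  norm_num [hz₀] at hκ

theorem range_bentMap_apply {z₀ : F} (h : Function.Injective (bentMap A ℓ (A z₀))) :
    range (bentMap A ℓ (A z₀)) = range A := by
  refine Subset.antisymm (range_subset_iff.2 fun z => ⟨_, (bentMap_apply_eq z).symm⟩) ?_
  rintro _ ⟨y, rfl⟩
  obtain ⟨r, hr⟩ : ∃ r : ℝ, r + |r| * ℓ z₀ = ℓ y := by
    have hκ := abs_lt.1 (abs_lt_one_of_injective_bentMap h)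
    obtain hy | hy := le_total 0 (ℓ y)
    · refine ⟨ℓ y / (1 + ℓ z₀), ?_⟩
      rw [abs_of_nonneg (div_nonneg hy (by linarith))]
      field_simp [show 1 + ℓ z₀ ≠ 0 by linarith]
    · refine ⟨ℓ y / (1 - ℓ z₀), ?_⟩
      rw [abs_of_nonpos (div_nonpos_of_nonpos_of_nonneg hy (by linarith))]
      field_simp [show 1 - ℓ z₀ ≠ 0 by linarith]
      ring
  have hℓ : ℓ (y - |r| • z₀) = r := by simp [← hr]
  exact ⟨y - |r| • z₀, by rw [bentMap_apply_eq, hℓ, sub_add_cancel]⟩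

variable [FiniteDimensional ℝ F]

theorem continuous_bentMap : Continuous (bentMap A ℓ v) :=
  A.continuous_of_finiteDimensional.add
    (ℓ.continuous_of_finiteDimensional.abs.smul continuous_const)

theorem exists_mul_norm_le_norm_bentMap (h : Function.Injective (bentMap A ℓ v)) :
    ∃ c > 0, ∀ z, c * ‖z‖ ≤ ‖bentMap A ℓ v z‖ := by
  have hpos : ∀ z ∈ Metric.sphere (0 : F) 1, 0 < ‖bentMap A ℓ v z‖ := by
    refine fun z hz => norm_pos_iff.2 fun h0 => ?_
    rw [h (h0.trans bentMap_zero.symm)] at hz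
    simp at hz
  obtain ⟨c, hc, hsphere⟩ := (isCompact_sphere (0 : F) 1).exists_forall_le'
    continuous_bentMap.norm.continuousOn hpos
  refine ⟨c, hc, fun z => ?_⟩
  obtain rfl | hz := eq_or_ne z 0
  · simp
  have := hsphere (‖z‖⁻¹ • z) (by simp [norm_smul, hz])
  rw [bentMap_smul (by positivity), norm_smul, norm_inv, norm_norm, inv_mul_eq_div] at this
  exact (le_div_iff₀ (norm_pos_iff.2 hz)).1 this

theorem map_bentMap_nhds_zero (h : Function.Injective (bentMap A ℓ v)) :
    map (bentMap A ℓ v) (𝓝 0) = 𝓝[range (bentMap A ℓ v)] 0 := by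
  obtain ⟨c, hc, hle⟩ := exists_mul_norm_le_norm_bentMap h
  have hcomap : comap (bentMap A ℓ v) (𝓝 0) = 𝓝 0 := by
    refine le_antisymm ?_ (tendsto_iff_comap.1 ?_)
    · refine tendsto_id'.1 (squeeze_zero_norm (fun z => (le_div_iff₀' hc).2 (hle z)) ?_)
      simpa using (tendsto_comap (x := 𝓝 (0 : E))).norm.div_const c
    · simpa using continuous_bentMap.tendsto (0 : F)
  rw [← hcomap, map_comap, nhdsWithin]

variable [FiniteDimensional ℝ E]

theorem exists_linearMap_eq_add_smul_iff (hA : Function.Injective A) (hu : u ∉ range A)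
    (hdim : finrank ℝ E = finrank ℝ F + 1) :
    ∃ (a : E →ₗ[ℝ] F) (r : E →ₗ[ℝ] ℝ), ∀ y z c, A z + c • u = y ↔ z = a y ∧ c = r y := by
  have hinj : Function.Injective (A.coprod (.toSpanSingleton ℝ E u)) := by
    refine (injective_iff_map_eq_zero _).2 fun ⟨z, c⟩ hzc => ?_
    simp only [LinearMap.coprod_apply, LinearMap.toSpanSingleton_apply] at hzc
    obtain rfl : c = 0 := by
      by_contra hc
      refine hu ⟨-(c⁻¹ • z), ?_⟩
      rw [map_neg, map_smul, eq_neg_of_add_eq_zero_left hzc, smul_neg, neg_neg, smul_smul,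
        inv_mul_cancel₀ hc, one_smul]
    simpa [map_eq_zero_iff A hA] using hzc
  let e := LinearMap.linearEquivOfInjective _ hinj (by simp [hdim])
  refine ⟨.fst ℝ F ℝ ∘ₗ e.symm, .snd ℝ F ℝ ∘ₗ e.symm, fun y z c => ?_⟩
  exact (e.eq_symm_apply (x := y) (y := (z, c))).symm.trans Prod.ext_iff

theorem exists_mem_range_bentMap_iff (h : Function.Injective (bentMap A ℓ v))
    (hdim : finrank ℝ E = finrank ℝ F + 1) :
    ∃ s t : E →ₗ[ℝ] ℝ, (∃ w, 0 < s w ∧ 0 < t w) ∧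
      ∀ y, y ∈ range (bentMap A ℓ v) ↔ min (s y) (t y) = 0 := by
  have hA := injective_of_injective_bentMap h
  by_cases hv : v ∈ range A
  · obtain ⟨z₀, rfl⟩ := hv
    obtain ⟨u, hu⟩ : ∃ u, u ∉ range A := by
      by_contra! hsurj
      have := LinearMap.finrank_le_finrank_of_surjective (f := A) hsurj
      omega
    obtain ⟨a, r, har⟩ := exists_linearMap_eq_add_smul_iff hA hu hdim
    have hru : 1 = r u := ((har u 0 1).1 (by simp)).2
    refine ⟨r, r, ⟨u, by simp [← hru]⟩, fun y => ?_⟩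
    rw [range_bentMap_apply h, min_self]
    simpa [eq_comm] using exists_congr fun z => har y z 0
  · obtain ⟨a, r, har⟩ := exists_linearMap_eq_add_smul_iff hA hv hdim
    have hav : 0 = a v ∧ 1 = r v := (har v 0 1).1 (by simp)
    refine ⟨r - ℓ ∘ₗ a, r + ℓ ∘ₗ a, ⟨v, by simp [← hav.1, ← hav.2]⟩, fun y => ?_⟩
    have hmin : min (r y - ℓ (a y)) (r y + ℓ (a y)) = r y - |ℓ (a y)| := by
      grind
    have hrange : y ∈ range (bentMap A ℓ v) ↔ ∃ z, z = a y ∧ |ℓ z| = r y :=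
      exists_congr fun z => har y z _
    simp only [LinearMap.sub_apply, LinearMap.add_apply, LinearMap.comp_apply, hmin, hrange,
      exists_eq_left, sub_eq_zero, eq_comm (b := r y)]

theorem IsBentAt.isBentHyperplaneAt {φ : F → E} {q : F} {S : Set E} {V : Set F}
    (hφ : IsBentAt φ q) (hV : V ∈ 𝓝 q) (hinj : InjOn φ V) (hmap : map φ (𝓝 q) = 𝓝[S] (φ q))
    (hdim : finrank ℝ E = finrank ℝ F + 1) : IsBentHyperplaneAt S (φ q) := by
  obtain ⟨A, ℓ, v, hφ⟩ := hφ
  have hbent : ∀ᶠ z in 𝓝 (0 : F), φ (z + q) = bentMap A ℓ v z + φ q := by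
    rw [← map_add_right_nhds_zero, eventually_map] at hφ
    simpa only [add_sub_cancel_right, add_comm (φ q)] using hφ
  have hbinj : Function.Injective (bentMap A ℓ v) := by
    rw [← map_add_right_nhds_zero, mem_map] at hV
    refine injective_bentMap_of_injOn (inter_mem hV hbent) fun z hz z' hz' hzz' => ?_
    exact add_right_cancel (hinj hz.1 hz'.1 (by rw [hz.2, hz'.2, hzz']))
  have hnhds : 𝓝[S] (φ q) = 𝓝[(· + -φ q) ⁻¹' range (bentMap A ℓ v)] (φ q) := calc
    𝓝[S] (φ q) = map (fun z => φ (z + q)) (𝓝 0) := by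
      rw [← hmap, ← map_add_right_nhds_zero, map_map, Function.comp_def]
    _ = map (· + φ q) (map (bentMap A ℓ v) (𝓝 0)) := by rw [map_congr hbent, map_map]; rfl
    _ = 𝓝[(· + φ q) '' range (bentMap A ℓ v)] (0 + φ q) := by
      rw [map_bentMap_nhds_zero hbinj]
      exact (Homeomorph.addRight (φ q)).isEmbedding.map_nhdsWithin_eq _ _
    _ = _ := by rw [zero_add, image_add_right]
  obtain ⟨s, t, hw, hst⟩ := exists_mem_range_bentMap_iff hbinj hdim
  refine ⟨s, t, hw, (nhdsWithin_eq_iff_eventuallyEq.1 hnhds).mem_iff.mono fun y hy => ?_⟩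
  rw [hy, ← hst, sub_eq_add_neg, mem_preimage]

end BentMap

section BentHyperplane

variable {E : Type*} [NormedAddCommGroup E] [NormedSpace ℝ E]
  {s t : E →ₗ[ℝ] ℝ} {S U : Set E} {b : E}

theorem isPreconnected_inter_setOf_min_pos (hUc : Convex ℝ U) :
    IsPreconnected (U ∩ {y | 0 < min (s (y - b)) (t (y - b))}) := by
  have heq : U ∩ {y | 0 < min (s (y - b)) (t (y - b))} =
      U ∩ {y | s b < s y} ∩ {y | t b < t y} := by
    ext y
    simp [and_assoc]
  rw [heq]
  exact ((hUc.inter (convex_halfSpace_gt s.isLinear _)).inter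
    (convex_halfSpace_gt t.isLinear _)).isPreconnected

theorem tendsto_add_smul_nhdsGT_zero (y w : E) :
    Tendsto (fun c : ℝ => y + c • w) (𝓝[>] 0) (𝓝 y) :=
  Tendsto.mono_left ((by fun_prop : Continuous fun c : ℝ => y + c • w).tendsto' 0 y (by simp))
    nhdsWithin_le_nhds

theorem isPreconnected_inter_setOf_min_neg (hw : ∃ w, 0 < s w ∧ 0 < t w) (hU : IsOpen U)
    (hUc : Convex ℝ U) (hbU : b ∈ U) :
    IsPreconnected (U ∩ {y | min (s (y - b)) (t (y - b)) < 0}) := by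
  have heq : U ∩ {y | min (s (y - b)) (t (y - b)) < 0} =
      U ∩ {y | s y < s b} ∪ U ∩ {y | t y < t b} := by
    ext y
    simp [← and_or_left]
  rw [heq]
  obtain ⟨w, hsw, htw⟩ := hw
  obtain ⟨c, hcU, hc : 0 < c⟩ := (((tendsto_add_smul_nhdsGT_zero b (-w)).eventually
    (hU.mem_nhds hbU)).and self_mem_nhdsWithin).exists
  exact .union (b + c • -w) ⟨hcU, by simp [hc, hsw]⟩ ⟨hcU, by simp [hc, htw]⟩
    (hUc.inter (convex_halfSpace_lt s.isLinear _)).isPreconnected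
    (hUc.inter (convex_halfSpace_lt t.isLinear _)).isPreconnected

theorem mem_closure_inter_of_forall_add_smul (hU : IsOpen U) {y w : E} (hy : y ∈ U) {P : Set E}
    (hP : ∀ c > (0 : ℝ), y + c • w ∈ P) : y ∈ closure (U ∩ P) :=
  mem_closure_of_tendsto (tendsto_add_smul_nhdsGT_zero y w)
    (((tendsto_add_smul_nhdsGT_zero y w).eventually (hU.mem_nhds hy)).and
      (eventually_nhdsWithin_of_forall hP))

theorem isTwoSidedCut_of_mem_iff_min_eq_zero [FiniteDimensional ℝ E]
    (hw : ∃ w, 0 < s w ∧ 0 < t w) (hU : IsOpen U) (hUc : Convex ℝ U) (hbU : b ∈ U)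
    (hS : ∀ y ∈ U, y ∈ S ↔ min (s (y - b)) (t (y - b)) = 0) :
    IsTwoSidedCut S U (U ∩ {y | 0 < min (s (y - b)) (t (y - b))})
      (U ∩ {y | min (s (y - b)) (t (y - b)) < 0}) := by
  have hcont : Continuous fun y => min (s (y - b)) (t (y - b)) := by
    have := s.continuous_of_finiteDimensional
    have := t.continuous_of_finiteDimensional
    fun_prop
  have hzero : ∀ y ∈ U ∩ S, min (s (y - b)) (t (y - b)) = 0 := fun y hy => (hS y hy.1).1 hy.2
  refine ⟨hU, hU.inter (isOpen_lt continuous_const hcont),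
    hU.inter (isOpen_lt hcont continuous_const), isPreconnected_inter_setOf_min_pos hUc,
    isPreconnected_inter_setOf_min_neg hw hU hUc hbU, ?_, ?_, fun y hy => ?_, fun y hy => ?_⟩
  · exact disjoint_left.2 fun y hy hy' => (mem_ofPred.1 hy.2).not_gt hy'.2
  · ext y
    rw [← inter_union_distrib_left, Set.mem_sdiff, mem_inter_iff, mem_union, mem_ofPred, mem_ofPred,
      lt_or_lt_iff_ne]
    exact and_congr_right fun hyU => by rw [hS y hyU, ne_comm]
  · obtain ⟨w, hsw, htw⟩ := hw
    refine mem_closure_inter_of_forall_add_smul (w := w) hU hy.1 fun c hc => ?_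
    have hy0 := hzero y hy
    simp only [mem_ofPred, add_sub_right_comm, map_add, map_smul, smul_eq_mul]
    exact hy0.symm.trans_lt (min_lt_min (lt_add_of_pos_right _ (mul_pos hc hsw))
      (lt_add_of_pos_right _ (mul_pos hc htw)))
  · obtain ⟨w, hsw, htw⟩ := hw
    refine mem_closure_inter_of_forall_add_smul (w := -w) hU hy.1 fun c hc => ?_
    have hy0 := hzero y hy
    simp only [mem_ofPred, add_sub_right_comm, map_add, map_smul, map_neg, smul_eq_mul, mul_neg]
    exact (min_lt_min (add_lt_of_neg_right _ (neg_neg_of_pos (mul_pos hc hsw)))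
      (add_lt_of_neg_right _ (neg_neg_of_pos (mul_pos hc htw)))).trans_eq hy0

theorem IsBentHyperplaneAt.twoSidedAt [FiniteDimensional ℝ E] (h : IsBentHyperplaneAt S b) :
    TwoSidedAt S b := by
  obtain ⟨s, t, hw, hS⟩ := h
  intro W hW
  obtain ⟨ε, hε, hball⟩ := Metric.mem_nhds_iff.1 (inter_mem hW hS)
  exact ⟨Metric.ball b ε, _, _, fun y hy => (hball hy).1, Metric.mem_ball_self hε,
    isTwoSidedCut_of_mem_iff_min_eq_zero hw Metric.isOpen_ball (convex_ball b ε)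
      (Metric.mem_ball_self hε) fun y hy => (hball hy).2⟩

end BentHyperplane

section PiecewiseAffine

open Module

variable {E F : Type*} [NormedAddCommGroup E] [NormedSpace ℝ E] [NormedAddCommGroup F]
  [NormedSpace ℝ F] {φ : F → E} {q : F} {C : Set F} {𝒟 : Set (Set F)}

/-- `𝒟` is a family of pieces for `φ`: finitely many closed sets with thin frontiers, on each of
which `φ` is affine. Unlike in `IsPLOn`, the pieces need not be bounded, nor cover a given set
exactly, so they can be pulled back along affine maps. -/
structure IsAffinePieces (φ : F → E) (𝒟 : Set (Set F)) : Prop where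
  finite : 𝒟.Finite
  isClosed : ∀ D ∈ 𝒟, IsClosed D
  isThin_frontier : ∀ D ∈ 𝒟, IsThin 1 (frontier D)
  exists_eqOn : ∀ D ∈ 𝒟, ∃ a : F →ᵃ[ℝ] E, EqOn φ a D

/-- A convex set that crosses no frontier of a piece lies in a single piece. -/
theorem IsAffinePieces.exists_linearMap (h : IsAffinePieces φ 𝒟) (hC : Convex ℝ C)
    (hCne : C.Nonempty) (hcover : C ⊆ ⋃₀ 𝒟) (hdisj : Disjoint C (⋃ D ∈ 𝒟, frontier D)) :
    ∃ A : F →ₗ[ℝ] E, ∀ q ∈ closure C, ∀ x ∈ closure C, φ x = φ q + A (x - q) := by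
  obtain ⟨y, hy⟩ := hCne
  obtain ⟨D, hD, hyD⟩ := hcover hy
  have hCD : Disjoint C (frontier D) := hdisj.mono_right (subset_biUnion_of_mem hD)
  have hint : ∀ x ∈ C, x ∈ D → x ∈ interior D := fun x hx hxD => by
    by_contra hxi
    exact hCD.notMem_of_mem_left hx ⟨subset_closure hxD, hxi⟩
  have hsub : C ⊆ interior D := hC.isPreconnected.subset_left_of_subset_union isOpen_interior
    (h.isClosed D hD).isOpen_compl (disjoint_compl_right.mono_left interior_subset)
    (fun x hx => (em (x ∈ D)).imp (hint x hx) id) ⟨y, hy, hint y hy hyD⟩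
  have hclosure : closure C ⊆ D :=
    closure_minimal (hsub.trans interior_subset) (h.isClosed D hD)
  obtain ⟨a, ha⟩ := h.exists_eqOn D hD
  refine ⟨a.linear, fun q hq x hx => ?_⟩
  rw [ha (hclosure hq), ha (hclosure hx), ← vsub_eq_sub, a.linearMap_vsub, vsub_eq_sub,
    add_sub_cancel]

theorem IsAffinePieces.exists_linearMap_halfSpace (h : IsAffinePieces φ 𝒟)
    (hcover : ∀ᶠ x in 𝓝 q, x ∈ ⋃₀ 𝒟) {ℓ : F →ₗ[ℝ] ℝ} (hℓ : ℓ ≠ 0)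
    (hker : ∀ᶠ x in 𝓝 q, x ∈ ⋃ D ∈ 𝒟, frontier D → ℓ (x - q) = 0) :
    ∃ A : F →ₗ[ℝ] E, ∀ᶠ x in 𝓝 q, 0 ≤ ℓ (x - q) → φ x = φ q + A (x - q) := by
  obtain ⟨ε, hε, hball⟩ := Metric.mem_nhds_iff.1 (hcover.and hker)
  obtain ⟨w, hw⟩ : ∃ w, 0 < ℓ w := by
    obtain ⟨w, hw⟩ := DFunLike.ne_iff.1 hℓ
    obtain hneg | hpos := hw.lt_or_gt
    · exact ⟨-w, by simpa using hneg⟩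
    · exact ⟨w, hpos⟩
  have hmem : ∀ x ∈ Metric.ball q ε, 0 ≤ ℓ (x - q) →
      x ∈ closure (Metric.ball q ε ∩ {y | ℓ q < ℓ y}) := fun x hx hxq => by
    refine mem_closure_inter_of_forall_add_smul (w := w) Metric.isOpen_ball hx fun c hc => ?_
    rw [map_sub, sub_nonneg] at hxq
    simpa using hxq.trans_lt (lt_add_of_pos_right _ (mul_pos hc hw))
  have hq := hmem q (Metric.mem_ball_self hε) (by simp)
  obtain ⟨A, hA⟩ := h.exists_linearMap ((convex_ball q ε).inter (convex_halfSpace_gt ℓ.isLinear _))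
    (closure_nonempty_iff.1 ⟨q, hq⟩) (fun x hx => (hball hx.1).1)
    (disjoint_left.2 fun x hx hxD => by
      have := (hball hx.1).2 hxD
      rw [map_sub, sub_eq_zero] at this
      exact hx.2.ne' this)
  exact ⟨A, eventually_of_mem (Metric.ball_mem_nhds q hε) fun x hx hxq => hA q hq x (hmem x hx hxq)⟩

theorem IsAffinePieces.isBentAt_of_ker (h : IsAffinePieces φ 𝒟)
    (hcover : ∀ᶠ x in 𝓝 q, x ∈ ⋃₀ 𝒟) {ℓ : F →ₗ[ℝ] ℝ} (hℓ : ℓ ≠ 0)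
    (hker : ∀ᶠ x in 𝓝 q, x ∈ ⋃ D ∈ 𝒟, frontier D → ℓ (x - q) = 0) : IsBentAt φ q := by
  obtain ⟨A₁, h₁⟩ := h.exists_linearMap_halfSpace hcover hℓ hker
  obtain ⟨A₂, h₂⟩ := h.exists_linearMap_halfSpace hcover (neg_ne_zero.2 hℓ)
    (hker.mono fun x hx hxD => neg_eq_zero.2 (hx hxD))
  have hA : ∀ z, ℓ z = 0 → A₁ z = A₂ z := fun z hz => by
    obtain ⟨c, ⟨h₁, h₂⟩, hc⟩ :=
      (((tendsto_add_smul_nhdsGT_zero q z).eventually (h₁.and h₂)).and self_mem_nhdsWithin).exists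
    have hc0 : (0 : ℝ) < c := hc
    simp only [add_sub_cancel_left, map_smul, LinearMap.neg_apply, hz, smul_zero, neg_zero, le_rfl,
      forall_const] at h₁ h₂
    exact smul_right_injective E hc0.ne' (add_left_cancel (h₁.symm.trans h₂))
  obtain ⟨A, v, hAv⟩ := exists_bentMap_eq_of_eqOn_ker hA
  refine ⟨A, ℓ, v, ?_⟩
  filter_upwards [h₁, h₂] with x h₁ h₂
  obtain hx | hx := le_total 0 (ℓ (x - q))
  · rw [h₁ hx, (hAv _).1 hx]
  · rw [h₂ (neg_nonneg.2 hx), (hAv _).2 hx]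

variable [FiniteDimensional ℝ F]

theorem IsAffinePieces.exists_isThin_forall_isBentAt (h : IsAffinePieces φ 𝒟) :
    ∃ T, IsThin 2 T ∧ ∀ q ∉ T, (∀ᶠ x in 𝓝 q, x ∈ ⋃₀ 𝒟) → IsBentAt φ q := by
  obtain ⟨T, hT, hlocal⟩ :=
    (isThin_biUnion h.finite h.isThin_frontier).exists_locally_subset_affineSubspace
  refine ⟨T, hT, fun q hq hcover => ?_⟩
  obtain hfree | ⟨A, hqA, hdim, hA⟩ := hlocal q hq
  · obtain ⟨ε, hε, hball⟩ := Metric.mem_nhds_iff.1 (hcover.and hfree)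
    obtain ⟨A, hA⟩ := h.exists_linearMap (convex_ball q ε) (Metric.nonempty_ball.2 hε)
      (fun x hx => (hball hx).1) (disjoint_left.2 fun x hx => (hball hx).2)
    refine ⟨A, 0, 0, eventually_of_mem (Metric.ball_mem_nhds q hε) fun x hx => ?_⟩
    simpa [bentMap] using
      hA q (subset_closure (Metric.mem_ball_self hε)) x (subset_closure hx)
  · have hlt : A.direction < ⊤ := Submodule.lt_top_of_finrank_lt_finrank (by omega)
    obtain ⟨ℓ, hℓ, hker⟩ := A.direction.exists_le_ker_of_lt_top hlt
    exact h.isBentAt_of_ker hcover hℓ (hA.mono fun x hx hxD =>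
      hker (AffineSubspace.vsub_mem_direction (hx hxD) hqA))

theorem IsAffinePieces.isThin_image (h : IsAffinePieces φ 𝒟) {T : Set F} {c d : ℕ}
    (hT : IsThin c T) (hcover : T ⊆ ⋃₀ 𝒟) (hdim : finrank ℝ E = finrank ℝ F + d) :
    IsThin (c + d) (φ '' T) := by
  refine (isThin_biUnion h.finite (T := fun D => φ '' (T ∩ D)) fun D hD => ?_).mono ?_
  · obtain ⟨a, ha⟩ := h.exists_eqOn D hD
    rw [(ha.mono inter_subset_right).image_eq]
    exact (hT.mono inter_subset_left).image a hdim
  · rintro _ ⟨x, hx, rfl⟩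
    obtain ⟨D, hD, hxD⟩ := hcover hx
    exact mem_iUnion₂.2 ⟨D, hD, mem_image_of_mem φ ⟨hx, hxD⟩⟩

end PiecewiseAffine

section Charts

variable {X Y : Type*} [TopologicalSpace X] [TopologicalSpace Y]

section Transport

variable {e : OpenPartialHomeomorph Y X} {B U U₁ U₂ : Set Y} {K : Set X} {y : Y}

theorem LocallyNonseparatingAt.of_preimage (h : LocallyNonseparatingAt (e ⁻¹' K) y)
    (hy : y ∈ e.source) : LocallyNonseparatingAt K (e y) := by
  intro W hW
  obtain ⟨V, hV, hVW, hVc⟩ :=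
    h _ (inter_mem (e.open_source.mem_nhds hy) ((e.continuousAt hy).preimage_mem_nhds hW))
  refine ⟨e '' V, e.image_mem_nhds hy hV, image_subset_iff.2 fun z hz => (hVW hz).2, ?_⟩
  rw [← image_sdiff_preimage]
  exact hVc.image _ (e.continuousOn.mono fun z hz => (hVW hz.1).1)

theorem IsTwoSidedCut.image (h : IsTwoSidedCut (e ⁻¹' K) U U₁ U₂) (hU : U ⊆ e.source) :
    IsTwoSidedCut K (e '' U) (e '' U₁) (e '' U₂) := by
  have h₁ : U₁ ⊆ e.source := h.left_subset.trans (sdiff_subset.trans hU)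
  have h₂ : U₂ ⊆ e.source := h.symm.left_subset.trans (sdiff_subset.trans hU)
  have hclosure : ∀ {V}, U ∩ e ⁻¹' K ⊆ closure V → e '' U ∩ K ⊆ closure (e '' V) := by
    rintro V hV _ ⟨⟨z, hzU, rfl⟩, hzK⟩
    exact mem_closure_image (e.continuousAt (hU hzU)) (hV ⟨hzU, hzK⟩)
  exact
    { isOpen := e.isOpen_image_of_subset_source h.isOpen hU
      isOpen_left := e.isOpen_image_of_subset_source h.isOpen_left h₁
      isOpen_right := e.isOpen_image_of_subset_source h.isOpen_right h₂
      isPreconnected_left := h.isPreconnected_left.image _ (e.continuousOn.mono h₁)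
      isPreconnected_right := h.isPreconnected_right.image _ (e.continuousOn.mono h₂)
      disjoint := by
        rw [disjoint_iff_inter_eq_empty, ← e.injOn.image_inter h₁ h₂, h.disjoint.inter_eq,
          image_empty]
      sdiff_eq := by rw [← image_sdiff_preimage, h.sdiff_eq, image_union]
      subset_closure_left := hclosure h.subset_closure_left
      subset_closure_right := hclosure h.subset_closure_right }

theorem TwoSidedAt.of_preimage (h : TwoSidedAt (e ⁻¹' K) y) (hy : y ∈ e.source) :
    TwoSidedAt K (e y) := by
  intro W hW
  obtain ⟨U, U₁, U₂, hUW, hyU, hcut⟩ :=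
    h _ (inter_mem (e.open_source.mem_nhds hy) ((e.continuousAt hy).preimage_mem_nhds hW))
  exact ⟨_, _, _, image_subset_iff.2 fun z hz => (hUW hz).2, mem_image_of_mem e hyU,
    hcut.image fun z hz => (hUW hz).1⟩

theorem map_chart_comp_nhds_eq {E F : Type*} [TopologicalSpace E] [TopologicalSpace F]
    {e : OpenPartialHomeomorph X E} {e' : OpenPartialHomeomorph Y F} {j : Y → X}
    (hj : IsInducing j) (hsub : MapsTo j e'.source e.source) {q : F} (hq : q ∈ e'.target) :
    map (e ∘ j ∘ e'.symm) (𝓝 q) = 𝓝[e.symm ⁻¹' range j] (e (j (e'.symm q))) := by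
  have hjq := hsub (e'.map_target hq)
  rw [← map_map, ← map_map, e'.symm.map_nhds_eq hq, hj.map_nhds_eq, e.map_nhdsWithin_eq hjq,
    e.image_source_inter_eq', e.nhdsWithin_target_inter (e.map_source hjq)]

end Transport

variable (E : Type*) [NormedAddCommGroup E] [NormedSpace ℝ E] {c : ℕ} {K : Set X} {x : X}

/-- In some chart around `x` with values in `E`, the set `K` is thin near `x`. -/
def IsLocallyThinAt (c : ℕ) (K : Set X) (x : X) : Prop :=
  ∃ e : OpenPartialHomeomorph X E, x ∈ e.source ∧ ∃ U ∈ 𝓝 (e x), IsThin c (U ∩ e.symm ⁻¹' K)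

variable {E}

theorem IsLocallyThinAt.of_le {d : ℕ} (h : IsLocallyThinAt E c K x) (hd : d ≤ c) :
    IsLocallyThinAt E d K x := by
  obtain ⟨e, hx, U, hU, hthin⟩ := h
  exact ⟨e, hx, U, hU, hthin.of_le hd⟩

variable [FiniteDimensional ℝ E]

theorem IsLocallyThinAt.mem_closure_compl (h : IsLocallyThinAt E 1 K x) : x ∈ closure Kᶜ := by
  obtain ⟨e, hx, U, hU, hthin⟩ := h
  have hex : e x ∈ closure (e.symm ⁻¹' Kᶜ) := by
    refine closure_mono ?_ (hthin.dense_compl.open_subset_closure_inter isOpen_interior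
      (mem_interior_iff_mem_nhds.2 hU))
    exact fun y hy hyK => hy.2 ⟨interior_subset hy.1, hyK⟩
  rw [← e.left_inv hx]
  exact closure_mono (image_preimage_subset _ _)
    (mem_closure_image (e.continuousAt_symm (e.map_source hx)) hex)

theorem IsLocallyThinAt.locallyNonseparatingAt (h : IsLocallyThinAt E 2 K x) :
    LocallyNonseparatingAt K x := by
  obtain ⟨e, hx, U, hU, hthin⟩ := h
  suffices LocallyNonseparatingAt (e.symm ⁻¹' K) (e x) from
    e.left_inv hx ▸ this.of_preimage (e.map_source hx)
  intro W hW
  obtain ⟨r, hr, hball⟩ := Metric.mem_nhds_iff.1 (inter_mem hU hW)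
  refine ⟨_, Metric.ball_mem_nhds _ hr, fun y hy => (hball hy).2, ?_⟩
  have heq : Metric.ball (e x) r \ (e.symm ⁻¹' K) =
      Metric.ball (e x) r \ (U ∩ e.symm ⁻¹' K) := by
    ext y
    exact and_congr_right fun hy => not_congr (and_iff_right (hball hy).1).symm
  rw [heq]
  exact hthin.isPreconnected_sdiff Metric.isOpen_ball (convex_ball _ _)

theorem IsLocallyThinAt.exists_simplyConnectedSpace (h : IsLocallyThinAt E (c + 2) K x) :
    ∃ T : Set X, IsOpen T ∧ Disjoint T K ∧ SimplyConnectedSpace T ∧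
      ∀ᶠ y in 𝓝 x, IsLocallyThinAt E (c + 1) Tᶜ y := by
  obtain ⟨e, hx, U, hU, hthin⟩ := h
  obtain ⟨r, hr, hball⟩ := Metric.mem_nhds_iff.1
    (inter_mem (e.open_target.mem_nhds (e.map_source hx)) hU)
  obtain ⟨T, hT, hTo, hTK, ⟨z, hz, hstar⟩, hUT⟩ := hthin.exists_starConvex
    Metric.isOpen_ball (convex_ball (e x) r) (Metric.nonempty_ball.2 hr)
  have hTe : T ⊆ e.target := fun y hy => (hball (hT hy)).1
  refine ⟨e.symm '' T, e.isOpen_image_symm_of_subset_target hTo hTe, ?_, ?_, ?_⟩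
  · refine disjoint_left.2 ?_
    rintro _ ⟨y, hy, rfl⟩ hyK
    exact hTK.notMem_of_mem_left hy ⟨(hball (hT hy)).2, hyK⟩
  · have := hstar.contractibleSpace ⟨z, hz⟩
    have := (e.symm.homeomorphOfImageSubsetSource hTe rfl).symm.contractibleSpace
    infer_instance
  · filter_upwards [e.open_source.mem_nhds hx,
      (e.continuousAt hx).eventually (Metric.ball_mem_nhds _ hr)] with y hy hyU
    refine ⟨e, hy, _, Metric.isOpen_ball.mem_nhds hyU, hUT.mono ?_⟩
    exact fun p hp => ⟨hp.1, fun hpT => hp.2 (mem_image_of_mem _ hpT)⟩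

theorem isConnected_compl_of_isLocallyThinAt [ConnectedSpace X]
    (h : ∀ x, IsLocallyThinAt E 2 K x) : IsConnected Kᶜ := by
  have hdense : Dense Kᶜ := fun x => ((h x).of_le one_le_two).mem_closure_compl
  exact ⟨hdense.nonempty,
    isPreconnected_compl_of_locallyNonseparatingAt hdense fun x => (h x).locallyNonseparatingAt⟩

variable {F : Type*} [NormedAddCommGroup F] [NormedSpace ℝ F] [FiniteDimensional ℝ F] {j : Y → X}

theorem card_connectedComponents_of_isLocallyThinAt [SimplyConnectedSpace X]
    [LocallyPathConnectedSpace X] [ConnectedSpace Y] (hj : IsClosedEmbedding j)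
    (hX : ∀ y, IsLocallyThinAt E 3 (badSet (range j)) (j y))
    (hY : ∀ y, IsLocallyThinAt F 2 (j ⁻¹' badSet (range j)) y)
    {Z : Type*} [TopologicalSpace Z] {ι : Z → X} (hι : IsInducing ι)
    (hrange : range ι = (range j)ᶜ) : Nat.card (ConnectedComponents Z) = 2 := by
  have hclosed : IsClosed (range j) := hj.isClosed_range
  have hbad : badSet (range j) ⊆ range j := fun x hx => hx.1
  have hK : ∀ x, LocallyNonseparatingAt (badSet (range j)) x := fun x => by
    by_cases hx : x ∈ range j
    · obtain ⟨y, rfl⟩ := hx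
      exact ((hX y).of_le (by norm_num)).locallyNonseparatingAt
    · exact locallyNonseparatingAt_of_notMem_closure fun h => hx (closure_minimal hbad hclosed h)
  have hdense : Dense (badSet (range j))ᶜ := fun x => by
    by_cases hx : x ∈ badSet (range j)
    · obtain ⟨y, rfl⟩ := hbad hx
      exact ((hX y).of_le (by norm_num)).mem_closure_compl
    · exact subset_closure hx
  have hconn : IsConnected (range j \ badSet (range j)) := by
    have := (isConnected_compl_of_isLocallyThinAt hY).image j hj.continuous.continuousOn
    rwa [compl_eq_univ_sdiff, image_sdiff_preimage, image_univ] at this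
  obtain ⟨f, hf⟩ := exists_forall_sepAt hclosed hdense hK fun x hx => by
    obtain ⟨y, rfl⟩ := hbad hx
    obtain ⟨T, hTo, hTK, hTs, hT⟩ := (hX y).exists_simplyConnectedSpace
    refine ⟨T, hTo, hTK, hTs, hT.mono fun z hz => ⟨?_, hz.locallyNonseparatingAt⟩⟩
    simpa using (hz.of_le one_le_two).mem_closure_compl
  rw [card_connectedComponents_of_isInducing hι (φ := f), Nat.card_zmod]
  · exact hrange ▸ continuousOn_compl_of_sepAt hf
  · exact fun c => hrange ▸ isConnected_compl_inter_preimage hclosed hf c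
      (isPreconnected_compl_of_locallyNonseparatingAt hdense hK) hconn

section PiecewiseAffine

open Module

variable {e : OpenPartialHomeomorph X E} {e' : OpenPartialHomeomorph Y F}

variable (hj : IsEmbedding j) (hsub : MapsTo j e'.source e.source)
  (hdim : finrank ℝ E = finrank ℝ F + 1)
include hj hsub hdim

theorem twoSidedAt_range_of_isBentAt {q : F} (hq : q ∈ e'.target)
    (h : IsBentAt (e ∘ j ∘ e'.symm) q) : TwoSidedAt (range j) (j (e'.symm q)) := by
  have hjq := hsub (e'.map_target hq)
  have hinj : InjOn (e ∘ j ∘ e'.symm) e'.target :=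
    (e.injOn.comp hj.injective.injOn hsub).comp e'.symm.injOn e'.symm.mapsTo
  have hbent := h.isBentHyperplaneAt (e'.open_target.mem_nhds hq) hinj
    (map_chart_comp_nhds_eq hj.isInducing hsub hq) hdim
  exact e.left_inv hjq ▸ hbent.twoSidedAt.of_preimage (e.map_source hjq)

theorem isLocallyThinAt_badSet_range {ψ : F → E} {𝒟 : Set (Set F)} (h : IsAffinePieces ψ 𝒟)
    (hψ : EqOn (e ∘ j ∘ e'.symm) ψ e'.target) (hcover : e'.target ⊆ ⋃₀ 𝒟) {y : Y}
    (hy : y ∈ e'.source) :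
    IsLocallyThinAt E 3 (badSet (range j)) (j y) ∧
      IsLocallyThinAt F 2 (j ⁻¹' badSet (range j)) y := by
  obtain ⟨T, hT, hbent⟩ := h.exists_isThin_forall_isBentAt
  have hbad : ∀ q ∈ e'.target, j (e'.symm q) ∈ badSet (range j) → q ∈ T := fun q hq hqK => by
    by_contra hqT
    have hnear := e'.open_target.mem_nhds hq
    exact hqK.2 (twoSidedAt_range_of_isBentAt hj hsub hdim hq
      ((hbent q hqT (mem_of_superset hnear hcover)).congr (hψ.eventuallyEq_of_mem hnear)))
  obtain ⟨W, hW, hWe'⟩ := (hj.isInducing.nhds_eq_comap y ▸ e'.open_source.mem_nhds hy :)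
  refine ⟨⟨e, hsub hy, e.symm ⁻¹' W ∩ e.target, inter_mem ?_ (e.open_target.mem_nhds
    (e.map_source (hsub hy))), ?_⟩, e', hy, e'.target, e'.open_target.mem_nhds (e'.map_source hy),
    hT.mono fun q hq => hbad q hq.1 hq.2⟩
  · refine (e.continuousAt_symm (e.map_source (hsub hy))).preimage_mem_nhds ?_
    rwa [e.left_inv (hsub hy)]
  · refine (h.isThin_image (hT.mono inter_subset_left)
      (inter_subset_right.trans hcover) hdim).mono ?_
    rintro p ⟨⟨hpW, hp⟩, hpK⟩
    obtain ⟨z, hz⟩ := hpK.1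
    have hze' : z ∈ e'.source := hWe' (hz ▸ hpW : j z ∈ W)
    refine ⟨e' z, ⟨hbad _ (e'.map_source hze') ?_, e'.map_source hze'⟩, ?_⟩
    · rwa [e'.left_inv hze', hz]
    · rw [← hψ (e'.map_source hze'), Function.comp_apply, Function.comp_apply, e'.left_inv hze',
        hz, e.right_inv hp]

end PiecewiseAffine

end Charts

section PiecewiseLinear

open Module

variable {E F : Type*} [NormedAddCommGroup E] [NormedSpace ℝ E] [FiniteDimensional ℝ E]
  [NormedAddCommGroup F] [NormedSpace ℝ F]

theorem IsConvexCell.isCompact {C : Set F} (h : IsConvexCell C) : IsCompact C := by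
  obtain ⟨s, hs, rfl⟩ := h
  exact hs.isCompact_convexHull ℝ

theorem IsConvexCell.isThin_frontier_preimage {C : Set F} (h : IsConvexCell C) (a : E →ᵃ[ℝ] F) :
    IsThin 1 (frontier (a ⁻¹' C)) := by
  obtain ⟨s, hs, rfl⟩ := h
  exact isThin_frontier_preimage_convexHull a hs

theorem IsCompactPolyhedron.isCompact {P : Set F} (h : IsCompactPolyhedron P) : IsCompact P := by
  obtain ⟨𝒞, hfin, hcell, rfl⟩ := h
  exact hfin.isCompact_sUnion fun C hC => (hcell C hC).isCompact

theorem IsPLOn.continuousOn {f : E → F} {P : Set E} (h : IsPLOn f P) : ContinuousOn f P := by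
  obtain ⟨𝒞, ⟨hfin, hcell, rfl⟩, haff⟩ := h
  have : Finite 𝒞 := hfin
  rw [sUnion_eq_iUnion]
  refine (locallyFinite_of_finite _).continuousOn_iUnion
    (fun C => (hcell C C.2).isCompact.isClosed) fun C => ?_
  obtain ⟨a, ha⟩ := haff C C.2
  exact a.continuous_of_finiteDimensional.continuousOn.congr ha

theorem IsPLOn.exists_isAffinePieces_comp {G : Type*} [NormedAddCommGroup G] [NormedSpace ℝ G]
    {g : E → F} {f : F → G} {Q : Set E} {N : Set F} (hg : IsPLOn g Q) (hf : IsPLOn f N) :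
    ∃ 𝒟, IsAffinePieces (f ∘ g) 𝒟 ∧ Q ∩ g ⁻¹' N ⊆ ⋃₀ 𝒟 := by
  obtain ⟨𝒞, ⟨hfin, hcell, rfl⟩, haff⟩ := hg
  obtain ⟨𝒞', ⟨hfin', hcell', rfl⟩, haff'⟩ := hf
  choose! a ha using haff
  choose! b hb using haff'
  refine ⟨image2 (fun C D => C ∩ a C ⁻¹' D) 𝒞 𝒞', ⟨hfin.image2 _ hfin', ?_, ?_, ?_⟩, ?_⟩
  · rintro _ ⟨C, hC, D, hD, rfl⟩
    exact (hcell C hC).isCompact.isClosed.inter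
      ((hcell' D hD).isCompact.isClosed.preimage (a C).continuous_of_finiteDimensional)
  · rintro _ ⟨C, hC, D, hD, rfl⟩
    have hC := (hcell C hC).isThin_frontier_preimage (AffineMap.id ℝ E)
    exact (hC.union ((hcell' D hD).isThin_frontier_preimage (a C))).mono
      ((frontier_inter_subset _ _).trans
        (union_subset_union inter_subset_left inter_subset_right))
  · rintro _ ⟨C, hC, D, hD, rfl⟩
    refine ⟨(b D).comp (a C), fun x hx => ?_⟩
    rw [Function.comp_apply, ha C hC hx.1, hb D hD hx.2, AffineMap.comp_apply]
  · rintro x ⟨⟨C, hC, hxC⟩, D, hD, hxD⟩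
    exact ⟨_, mem_image2_of_mem hC hD, hxC, by rwa [mem_preimage, ← ha C hC hxC]⟩

theorem exists_openPartialHomeomorph_of_invOn {X Y : Type*} [TopologicalSpace X]
    [TopologicalSpace Y] {f : X → Y} {g : Y → X} {s : Set X} {t : Set Y} (hs : IsOpen s)
    (ht : IsOpen t) (hf : ContinuousOn f s) (hg : ContinuousOn g t) (h : InvOn g f s t) :
    ∃ e : OpenPartialHomeomorph X Y,
      e.source = s ∩ f ⁻¹' t ∧ e.target = t ∩ g ⁻¹' s ∧ ⇑e = f ∧ ⇑e.symm = g :=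
  ⟨{  toFun := f
      invFun := g
      source := s ∩ f ⁻¹' t
      target := t ∩ g ⁻¹' s
      map_source' := fun x hx => ⟨hx.2, by rw [mem_preimage, h.1 hx.1]; exact hx.1⟩
      map_target' := fun y hy => ⟨hy.2, by rw [mem_preimage, h.2 hy.1]; exact hy.1⟩
      left_inv' := fun x hx => h.1 hx.1
      right_inv' := fun y hy => h.2 hy.1
      open_source := hf.isOpen_inter_preimage hs ht
      open_target := hg.isOpen_inter_preimage ht hs
      continuousOn_toFun := hf.mono inter_subset_left
      continuousOn_invFun := hg.mono inter_subset_left }, rfl, rfl, rfl, rfl⟩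

section Chart

variable {m : ℕ} {P N : Set E} {f : E → Fin m → ℝ} {g : (Fin m → ℝ) → E}

theorem IsPLChartAt.map_nhdsWithin_eq {x : E} (h : IsPLChartAt m P x N f g) (hx : x ∈ P) :
    map g (𝓝[stdCube m] (f x)) = 𝓝[P] x := by
  obtain ⟨hNP, hN, hf, hg, hfN, hgN, hinv⟩ := h
  have hxN := mem_of_mem_nhdsWithin hx hN
  refine le_antisymm (tendsto_nhdsWithin_iff.2 ⟨?_, ?_⟩) (le_map_of_right_inverse ?_
    (tendsto_nhdsWithin_iff.2 ⟨(hf.continuousOn x hxN).mono_of_mem_nhdsWithin hN, ?_⟩))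
  · simpa only [ContinuousWithinAt, hinv.1 hxN] using hg.continuousOn (f x) (hfN hxN)
  · exact eventually_nhdsWithin_of_forall fun z hz => hNP (hgN hz)
  · exact eventually_of_mem hN fun y hy => hinv.1 hy
  · exact eventually_of_mem hN fun y hy => hfN hy

theorem IsPLManifold.locallyPathConnectedSpace (h : IsPLManifold m P) :
    LocallyPathConnectedSpace P := by
  refine ⟨fun x => hasBasis_self.2 fun W hW => ?_⟩
  obtain ⟨N, f, g, hchart⟩ := h.2 x x.2
  have hmap := hchart.map_nhdsWithin_eq x.2
  obtain ⟨hNP, hN, hf, hg, hfN, hgN, hinv⟩ := hchart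
  have hxN := mem_of_mem_nhdsWithin x.2 hN
  rw [mem_nhds_subtype_iff_nhdsWithin, ← hmap] at hW
  obtain ⟨r, hr, hball⟩ := Metric.mem_nhdsWithin_iff.1 hW
  have himage : Subtype.val '' (Subtype.val ⁻¹' (g '' (Metric.ball (f x) r ∩ stdCube m)) : Set P) =
      g '' (Metric.ball (f x) r ∩ stdCube m) := by
    rw [Subtype.image_preimage_coe, inter_eq_right, image_subset_iff]
    exact fun z hz => hNP (hgN hz.2)
  refine ⟨Subtype.val ⁻¹' (g '' (Metric.ball (f x) r ∩ stdCube m)), ?_, ?_, ?_⟩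
  · rw [mem_nhds_subtype_iff_nhdsWithin, himage, ← hmap]
    exact image_mem_map (inter_mem (mem_nhdsWithin_of_mem_nhds (Metric.ball_mem_nhds _ hr))
      self_mem_nhdsWithin)
  · rw [IsInducing.subtypeVal.isPathConnected_iff, himage]
    exact (((convex_ball _ _).inter (convex_Icc 0 1)).isPathConnected
      ⟨f x, Metric.mem_ball_self hr, hfN hxN⟩).image' (hg.continuousOn.mono inter_subset_right)
  · rw [← image_subset_image_iff Subtype.val_injective, himage]
    exact image_subset_iff.2 hball

theorem IsPLChartAt.exists_openPartialHomeomorph {x : P} (h : IsPLChartAt m P x N f g)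
    (hx : f x ∈ interior (stdCube m)) {W : Set P} (hW : W ∈ 𝓝 x) :
    ∃ e : OpenPartialHomeomorph P (Fin m → ℝ), x ∈ e.source ∧ e.source ⊆ W ∩ Subtype.val ⁻¹' N ∧
      (∀ y : P, e y = f y) ∧ e.target ⊆ stdCube m ∧ ∀ z ∈ e.target, (e.symm z : E) = g z := by
  obtain ⟨hNP, hN, hf, hg, hfN, hgN, hinv⟩ := h
  have : Nonempty P := ⟨x⟩
  have hlift : ∀ z ∈ stdCube m, ∃ y : P, (y : E) = g z := fun z hz => ⟨⟨g z, hNP (hgN hz)⟩, rfl⟩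
  choose! G hG using hlift
  have hN' : (Subtype.val ⁻¹' N : Set P) ∈ 𝓝 x := by
    rwa [mem_nhds_subtype_iff_nhdsWithin, Subtype.image_preimage_coe, inter_eq_right.2 hNP]
  have hfc : ContinuousOn (fun y : P => f y) (Subtype.val ⁻¹' N) :=
    hf.continuousOn.comp continuous_subtype_val.continuousOn (mapsTo_preimage _ _)
  have hGc : ContinuousOn G (stdCube m) :=
    IsInducing.subtypeVal.continuousOn_iff.2 (hg.continuousOn.congr hG)
  have hGinv : InvOn G (fun y : P => f y) (Subtype.val ⁻¹' N) (stdCube m) :=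
    ⟨fun y hy => Subtype.ext ((hG _ (hfN hy)).trans (hinv.1 hy)),
      fun z hz => (congrArg f (hG z hz)).trans (hinv.2 hz)⟩
  obtain ⟨e, hsource, htarget, he, hsymm⟩ := exists_openPartialHomeomorph_of_invOn
    isOpen_interior isOpen_interior
    (hfc.mono (interior_subset.trans (inter_subset_right (s := W)))) (hGc.mono interior_subset)
    (hGinv.mono (interior_subset.trans inter_subset_right) interior_subset)
  refine ⟨e, ?_, ?_, fun y => congrFun he y, ?_, fun z hz => ?_⟩
  · exact hsource ▸ ⟨mem_interior_iff_mem_nhds.2 (inter_mem hW hN'), hx⟩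
  · exact hsource ▸ inter_subset_left.trans interior_subset
  · exact htarget ▸ inter_subset_left.trans interior_subset
  · rw [hsymm]
    exact hG z (interior_subset (htarget ▸ hz).1)

end Chart

theorem isLocallyThinAt_badSet_inclusion {k : ℕ} {M B : Set E} (hB : B ⊆ plInterior k B)
    (hBM : B ⊆ plInterior (k + 1) M) (hsub : B ⊆ M) (b : B) :
    IsLocallyThinAt (Fin (k + 1) → ℝ) 3 (badSet (range (inclusion hsub))) (inclusion hsub b) ∧
      IsLocallyThinAt (Fin k → ℝ) 2 (inclusion hsub ⁻¹' badSet (range (inclusion hsub))) b := by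
  obtain ⟨-, N, f, g, hchart, hint⟩ := hBM b.2
  obtain ⟨-, N', f', g', hchart', hint'⟩ := hB b.2
  obtain ⟨e, hbe, heN, hef, -⟩ :=
    hchart.exists_openPartialHomeomorph (x := inclusion hsub b) hint univ_mem
  obtain ⟨e', hbe', hee', -, htarget, hsymm⟩ := hchart'.exists_openPartialHomeomorph hint'
    ((continuous_inclusion hsub).continuousAt.preimage_mem_nhds (e.open_source.mem_nhds hbe))
  obtain ⟨𝒟, h𝒟, hcover⟩ := hchart'.2.2.2.1.exists_isAffinePieces_comp hchart.2.2.1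
  refine isLocallyThinAt_badSet_range (IsEmbedding.inclusion hsub) (fun y hy => (hee' hy).1)
    (by simp) h𝒟 (fun z hz => ?_) (fun z hz => hcover ⟨htarget hz, ?_⟩) hbe'
  · simp only [Function.comp_apply, hef, hsymm z hz]
  · have hzN := (heN (hee' (e'.map_target hz)).1).2
    rwa [mem_preimage, coe_inclusion, hsymm z hz] at hzN

end PiecewiseLinear

theorem theorem4p5_general {E : Type*} [NormedAddCommGroup E] [NormedSpace ℝ E]
    [FiniteDimensional ℝ E] {k : ℕ} {M B : Set E} [SimplyConnectedSpace M]
    [LocallyPathConnectedSpace M] (hcl : IsClosed (Subtype.val ⁻¹' B : Set M))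
    (hB : B ⊆ plInterior k B) (hBc : IsConnected B) (hBM : B ⊆ plInterior (k + 1) M) :
    Nat.card (ConnectedComponents ↥(M \ B)) = 2 := by
  have hsub : B ⊆ M := fun b hb => (hBM hb).1
  have hrange : range (inclusion hsub) = Subtype.val ⁻¹' B := range_inclusion hsub
  have : ConnectedSpace B := isConnected_iff_connectedSpace.1 hBc
  have hthin := isLocallyThinAt_badSet_inclusion hB hBM hsub
  exact card_connectedComponents_of_isLocallyThinAt
    (j := inclusion hsub) ⟨.inclusion hsub, hrange ▸ hcl⟩ (fun b => (hthin b).1)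
    (fun b => (hthin b).2) (IsEmbedding.inclusion sdiff_subset).isInducing
    (by rw [range_inclusion, hrange]; ext; simp)

theorem theorem4p5 (n m : ℕ) (hm : 1 ≤ m) (M B : Set (EuclideanSpace ℝ (Fin n)))
    (hM : IsPLManifold m M) (hMsc : SimplyConnectedSpace M)
    (hB : IsClosedPLManifold (m - 1) B) (hBc : IsConnected B)
    (hBM : B ⊆ plInterior m M) :
    Nat.card (ConnectedComponents ↥(M \ B)) = 2 := by
  obtain ⟨k, rfl⟩ := Nat.exists_eq_add_of_le' hm
  have := hM.locallyPathConnectedSpace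
  exact theorem4p5_general (hB.1.1.isCompact.isClosed.preimage continuous_subtype_val) hB.2 hBc hBM
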